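/- Let $K,T\ge 1$ be integers, $\mu\in\mathbb{R}^K$, $\sigma>0$, $\gamma_T>0$, and $\Delta_a=\max_b\mu_b-\mu_a$ for $a\in[K]=\{1,\dots,K\}$. In round $t\in[T]$ an arm $A_t\in[K]$ is pulled, chosen from the past (possibly with additional randomisation that is independent of the present and future noises), and the reward $R_t=\mu_{A_t}+\sigma\xi_t$ is received, where $\xi_1,\dots,\xi_T$ are i.i.d. $\mathcal N(0,1)$. Let $n_{a;t}=\#\{s\le t:A_s=a\}$ and $\hat\mu_{a;t}=n_{a;t}^{-1}\sum_{s\le t:A_s=a}R_s$. The arms are chosen by UCB1 with exploration rate $\gamma_T$: each arm is pulled once in the first $K$ rounds, and for $K<t\le T$ $$A_t\in\operatorname*{arg\,max}_{a\in[K]}\Big\{\hat\mu_{a;t-1}+\frac{\sigma\gamma_T}{\sqrt{n_{a;t-1}}}\Big\},$$ with ties broken arbitrarily. Let $n_*>0$ be the unique positive solution of $$\sum_{a\in[K]}n_*\Big(1+\frac{n_*^{1/2}\Delta_a}{\sigma\gamma_T}\Big)^{-2}=T,$$ and set $$n^*_{a;T}=n_*\Big(1+\frac{n_*^{1/2}\Delta_a}{\sigma\gamma_T}\Big)^{-2},\qquad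 D_*=\frac1T\sum_{a\in[K]}\Big(\frac{n^*_{a;T}}{n_*}\Big)^{1/2}n^*_{a;T},$$ $$\mathrm{err}(\Theta)=\frac{\sqrt{\log\gamma_T}+\sqrt{\log\log T}}{\gamma_T}+\frac KT+\frac{\max_a(\Delta_a/\sigma)^2}{\gamma_T^2},\qquad \epsilon_T=\max\Big\{\frac{\sqrt{\log\gamma_T}+\sqrt{\log\log T}}{\gamma_T},\ \frac KT\Big\}.$$ There is a universal constant $C>0$ (depending on none of the quantities above, nor on $\gamma$) such that the following holds for every $\gamma\ge1$. If $$\mathrm{err}(\Theta)\vee\frac{\gamma}{\gamma_T}\le\frac1C\qquad\text{and}\qquad D_*^{-1}\epsilon_T\le\frac1C,$$ then $$\max_{a\in[K]}\mathbb P\Big(\Big|\frac{n_{a;T}}{n^*_{a;T}}-1\Big|\ge C\Big(D_*^{-1}\,\mathrm{err}(\Theta)+\frac{\gamma}{\gamma_T}\Big)\Big)\le C\Big(\gamma_T^{-100}+\log T\cdot\gamma e^{-\gamma^2/2}\Big).$$ (If $\gamma_T<1$ or $T\le 2$, square roots of negative numbers are read as $0$ and $\log 0$ as $0$; for $C\ge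 3$ the hypotheses exclude these cases.) -/

import Mathlib

open MeasureTheory ProbabilityTheory

noncomputable section

namespace Bandit

/-- Sub-optimality gap of arm `a` for the mean rewards `μ`: the largest mean minus `μ a`. -/
def gap {K : ℕ} (μ : Fin K → ℝ) (a : Fin K) : ℝ := (⨆ b, μ b) - μ a

/-! ### The fixed point equation and the deterministic quantities -/

/-- The noiseless number of pulls of arm `a` when the optimal arms get `n` pulls:
`n * (1 + n ^ (1 / 2) * Δ_a / (σ * γT)) ^ (-2)`. -/
def pullCurve {K : ℕ} (μ : Fin K → ℝ) (σ γT n : ℝ) (a : Fin K) : ℝ :=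
  n * ((1 + √n * gap μ a / (σ * γT)) ^ 2)⁻¹

/-- `n` is a positive solution of the fixed point equation with horizon `T`. -/
def IsNStar {K : ℕ} (μ : Fin K → ℝ) (σ γT : ℝ) (T : ℕ) (n : ℝ) : Prop :=
  0 < n ∧ ∑ a, pullCurve μ σ γT n a = T

theorem gap_nonneg {K : ℕ} (μ : Fin K → ℝ) (a : Fin K) : 0 ≤ gap μ a :=
  sub_nonneg.2 (le_ciSup (Set.finite_range μ).bddAbove a)

theorem exists_gap_eq_zero {K : ℕ} (hK : 0 < K) (μ : Fin K → ℝ) : ∃ a, gap μ a = 0 := by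
  have : Nonempty (Fin K) := ⟨⟨0, hK⟩⟩
  obtain ⟨a, ha⟩ := exists_eq_ciSup_of_finite (f := μ)
  exact ⟨a, by simp [gap, ha]⟩

theorem pullCurve_strictMonoOn {K : ℕ} (μ : Fin K → ℝ) {σ γT : ℝ} (hσ : 0 < σ) (hγ : 0 < γT)
    (a : Fin K) : StrictMonoOn (fun n => pullCurve μ σ γT n a) (Set.Ici 0) := by
  intro m hm n hn hmn
  have hm' : 0 ≤ m := hm
  have hn' : 0 ≤ n := hn
  set c : ℝ := gap μ a / (σ * γT) with hc
  have hc0 : 0 ≤ c := div_nonneg (gap_nonneg μ a) (by positivity)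
  have e : ∀ x : ℝ, 0 ≤ x → pullCurve μ σ γT x a = (√x / (1 + √x * c)) ^ 2 := by
    intro x hx
    rw [div_pow, Real.sq_sqrt hx, pullCurve, mul_div_assoc, ← hc, div_eq_mul_inv]
  have hs : √m < √n := Real.sqrt_lt_sqrt hm' hmn
  have hs0 : 0 ≤ √m := Real.sqrt_nonneg m
  have hs1 : 0 ≤ √n := Real.sqrt_nonneg n
  change pullCurve μ σ γT m a < pullCurve μ σ γT n a
  rw [e m hm', e n hn']
  refine pow_lt_pow_left₀ ?_ (by positivity) two_ne_zero
  rw [div_lt_div_iff₀ (by positivity) (by positivity)]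
  nlinarith

/-- The fixed point equation has exactly one positive solution, so that `nStar` below is
determined by it. -/
theorem existsUnique_isNStar {K T : ℕ} (hK : 0 < K) (hT : 0 < T) (μ : Fin K → ℝ) {σ γT : ℝ}
    (hσ : 0 < σ) (hγ : 0 < γT) : ∃! n : ℝ, IsNStar μ σ γT T n := by
  have : Nonempty (Fin K) := ⟨⟨0, hK⟩⟩
  have hT' : (0 : ℝ) < T := by exact_mod_cast hT
  have hmono : StrictMonoOn (fun n => ∑ a, pullCurve μ σ γT n a) (Set.Ici 0) := by
    intro m hm n hn hmn
    exact Finset.sum_lt_sum_of_nonempty Finset.univ_nonempty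
      (fun a _ => pullCurve_strictMonoOn μ hσ hγ a hm hn hmn)
  have hcont : ContinuousOn (fun n => ∑ a, pullCurve μ σ γT n a) (Set.Icc 0 (T : ℝ)) := by
    refine continuousOn_finsetSum _ fun a _ => ?_
    unfold pullCurve
    refine continuousOn_id.mul (ContinuousOn.inv₀ (by fun_prop) fun x _ => ?_)
    have : 0 ≤ √x * gap μ a / (σ * γT) :=
      div_nonneg (mul_nonneg (Real.sqrt_nonneg _) (gap_nonneg μ a)) (by positivity)
    positivity
  have h0 : ∑ a, pullCurve μ σ γT 0 a = 0 := by simp [pullCurve]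
  have h1 : (T : ℝ) ≤ ∑ a, pullCurve μ σ γT T a := by
    obtain ⟨a, ha⟩ := exists_gap_eq_zero hK μ
    have h2 : pullCurve μ σ γT T a = T := by simp [pullCurve, ha]
    have h3 : ∀ b ∈ Finset.univ, 0 ≤ pullCurve μ σ γT T b := by
      intro b _
      unfold pullCurve
      positivity
    calc (T : ℝ) = pullCurve μ σ γT T a := h2.symm
      _ ≤ _ := Finset.single_le_sum h3 (Finset.mem_univ a)
  obtain ⟨n, hn, hn'⟩ := intermediate_value_Icc hT'.le hcont
    (show (T : ℝ) ∈ Set.Icc _ _ from ⟨by simp [h0], h1⟩)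
  have hn' : ∑ a, pullCurve μ σ γT n a = T := hn'
  have hpos : 0 < n := by
    rcases hn.1.lt_or_eq with h | h
    · exact h
    · rw [← h, h0] at hn'
      exact absurd hn' hT'.ne
  refine ⟨n, ⟨hpos, hn'⟩, fun m hm => ?_⟩
  exact hmono.injOn hm.1.le hpos.le (hm.2.trans hn'.symm)

/-- The positive solution `n_*` of the fixed point equation (unique by `existsUnique_isNStar`). -/
def nStar {K : ℕ} (μ : Fin K → ℝ) (σ γT : ℝ) (T : ℕ) : ℝ :=
  Classical.epsilon (IsNStar μ σ γT T)

theorem isNStar_nStar {K T : ℕ} (hK : 0 < K) (hT : 0 < T) (μ : Fin K → ℝ) {σ γT : ℝ}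
    (hσ : 0 < σ) (hγ : 0 < γT) : IsNStar μ σ γT T (nStar μ σ γT T) :=
  Classical.epsilon_spec (existsUnique_isNStar hK hT μ hσ hγ).exists

/-- The deterministic number of pulls `n*_{a;T}` of arm `a`. -/
def nStarArm {K : ℕ} (μ : Fin K → ℝ) (σ γT : ℝ) (T : ℕ) (a : Fin K) : ℝ :=
  pullCurve μ σ γT (nStar μ σ γT T) a

/-- `D_* = T⁻¹ ∑_a (n*_{a;T} / n_*) ^ (1 / 2) n*_{a;T}`. -/
def DStar {K : ℕ} (μ : Fin K → ℝ) (σ γT : ℝ) (T : ℕ) : ℝ :=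
  1 / (T : ℝ) * ∑ a, √(nStarArm μ σ γT T a / nStar μ σ γT T) * nStarArm μ σ γT T a

/-- The common term `(√(log γT) + √(log log T)) / γT` of `err` and `epsT`. -/
def logRate (γT : ℝ) (T : ℕ) : ℝ :=
  (√(Real.log γT) + √(Real.log (Real.log T))) / γT

/-- The error term `err(Θ)`; the norm in the last summand is the sup norm on `Fin K → ℝ`. -/
def err {K : ℕ} (μ : Fin K → ℝ) (σ γT : ℝ) (T : ℕ) : ℝ :=
  logRate γT T + (K : ℝ) / T + ‖fun a => gap μ a / σ‖ ^ 2 / γT ^ 2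

/-- `ε_T = max {(√(log γT) + √(log log T)) / γT, K / T}`. -/
def epsT (K : ℕ) (γT : ℝ) (T : ℕ) : ℝ := max (logRate γT T) ((K : ℝ) / T)

/-! ### The bandit model and the UCB1 algorithm

Rounds are numbered `1, 2, 3, …`; `A t ω` is the arm pulled in round `t` and `ξ t ω` the scaled
noise in that round. -/

variable {Ω : Type*} {K : ℕ}

/-- The reward received in round `t`. -/
def reward (μ : Fin K → ℝ) (σ : ℝ) (ξ : ℕ → Ω → ℝ) (A : ℕ → Ω → Fin K) (t : ℕ) (ω : Ω) : ℝ :=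
  μ (A t ω) + σ * ξ t ω

/-- `n_{a;t}`: the number of pulls of arm `a` in the rounds `1, …, t`. -/
def pulls (A : ℕ → Ω → Fin K) (a : Fin K) (t : ℕ) (ω : Ω) : ℕ :=
  ((Finset.Icc 1 t).filter (fun s => A s ω = a)).card

/-- The empirical mean reward of arm `a` over the rounds `1, …, t`. -/
def empMean (μ : Fin K → ℝ) (σ : ℝ) (ξ : ℕ → Ω → ℝ) (A : ℕ → Ω → Fin K)
    (a : Fin K) (t : ℕ) (ω : Ω) : ℝ :=
  1 / (pulls A a t ω : ℝ) *
    ∑ s ∈ (Finset.Icc 1 t).filter (fun s => A s ω = a), reward μ σ ξ A s ω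

/-- The index `μ̂_{a;t} + σ γT / √(n_{a;t})` of arm `a` after round `t`. -/
def ucbIndex (μ : Fin K → ℝ) (σ γT : ℝ) (ξ : ℕ → Ω → ℝ) (A : ℕ → Ω → Fin K)
    (a : Fin K) (t : ℕ) (ω : Ω) : ℝ :=
  empMean μ σ ξ A a t ω + σ * γT / √(pulls A a t ω)

/-- The scaled noises of the rounds `1, …, T` are i.i.d. standard normal (each `ξ t` is standard
normal, known after round `t` and independent of everything known before round `t`), and every arm
`A t` is chosen from what is known before round `t`: the past, and possibly some randomisation
that does not anticipate the noise. -/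
structure IsBanditRun [mΩ : MeasurableSpace Ω] (P : Measure Ω) (ℱ : Filtration ℕ mΩ)
    (T : ℕ) (ξ : ℕ → Ω → ℝ) (A : ℕ → Ω → Fin K) : Prop where
  noise_measurable : ∀ t ∈ Finset.Icc 1 T, Measurable[ℱ t] (ξ t)
  noise_law : ∀ t ∈ Finset.Icc 1 T, P.map (ξ t) = gaussianReal 0 1
  noise_indep : ∀ t ∈ Finset.Icc 1 T,
    Indep (MeasurableSpace.comap (ξ t) inferInstance) (ℱ (t - 1)) P
  arm_measurable : ∀ t ∈ Finset.Icc 1 T, Measurable[ℱ (t - 1)] (A t)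

/-- The UCB1 rule with exploration rate `γT` and horizon `T`: each of the `K` arms is pulled once
in the first `K` rounds, and every later round pulls an arm of maximal index (ties are broken
arbitrarily). -/
structure IsUCB1 (μ : Fin K → ℝ) (σ γT : ℝ) (T : ℕ) (ξ : ℕ → Ω → ℝ) (A : ℕ → Ω → Fin K) :
    Prop where
  init : ∀ ω a, pulls A a K ω = 1
  step : ∀ t ∈ Finset.Icc (K + 1) T, ∀ ω b,
    ucbIndex μ σ γT ξ A b (t - 1) ω ≤ ucbIndex μ σ γT ξ A (A t ω) (t - 1) ω

end Bandit

end

/-! At the horizon all indices sit near one deterministic level, `max μ + σ γT / √n_*`. Perturb it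
to `level τ`; `levelPulls τ a` is the number of pulls at which the noiseless index of arm `a` equals
that level. Summed over the arms this is `T` at `τ = 0` and moves at rate of order `T * D_*` in `τ`.
A relative error `ε` in the total budget therefore becomes an error of order `ε / D_*` in the level,
and this is the source of `D_*⁻¹`.

Let `E τ` say that at some round in `[K, T)` all indices are at most `level τ`. With `δ = ε_T /
D_*`, it is shown that `E (200 δ)` holds and `E (-200 δ)` fails, up to probability of order `γT ^
(-100)`. If `E τ` fails, every pulled arm had index above the level, so the pulls can add up to `T`
only if noise causes many excess pulls (`measureReal_not_exists_le_level`). If `E τ` holds at `t`,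
every arm with tame noise has nearly `levelPulls τ` pulls, so `t < T` forces the other arms to carry
a sizeable share of the total (`measureReal_exists_le_level`). Both times Markov's inequality for a
weighted count replaces a union bound over arms, so no factor `K` appears in the probability.

Once the level is located, the count of a fixed arm depends only on its own noise, which a finite
law of the iterated logarithm keeps below `γ √n`. That costs `log T * γ * exp (-γ ^ 2 / 2)`. -/

noncomputable section

namespace Bandit

/-! ### A maximal inequality for products of predictably selected factors -/

/-- The running product of the factors `X s` over the rounds `s` with `ω ∈ B s`, frozen once it has
reached the level `c`. -/
def frozenProd {Ω : Type*} (c : ENNReal) (B : ℕ → Set Ω) (X : ℕ → Ω → ENNReal) :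
    ℕ → Ω → ENNReal
  | 0 => fun _ => 1
  | t + 1 => fun ω => frozenProd c B X t ω *
      (B (t + 1) ∩ {ω | frozenProd c B X t ω < c}).mulIndicator (X (t + 1)) ω

/-- After the level is reached all further factors are `1`, so the terminal value remembers the
running maximum. Freezing thus replaces a stopping time. -/
theorem le_frozenProd_or {Ω : Type*} (c : ENNReal) (B : ℕ → Set Ω) (X : ℕ → Ω → ENNReal)
    (ω : Ω) (t : ℕ) :
    c ≤ frozenProd c B X t ω ∨
      (frozenProd c B X t ω = ∏ s ∈ Finset.Icc 1 t, (B s).mulIndicator (X s) ω ∧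
        ∀ r ∈ Finset.Icc 1 t, ∏ s ∈ Finset.Icc 1 r, (B s).mulIndicator (X s) ω < c) := by
  induction t with
  | zero => right; simp [frozenProd]
  | succ t ih =>
    rcases le_or_gt c (frozenProd c B X t ω) with h | h
    · left
      simp only [frozenProd]
      rw [Set.mulIndicator_of_notMem (by simp [h]), mul_one]
      exact h
    · obtain ⟨h1, h2⟩ := ih.resolve_left h.not_ge
      have e : frozenProd c B X (t + 1) ω =
          ∏ s ∈ Finset.Icc 1 (t + 1), (B s).mulIndicator (X s) ω := by
        rw [frozenProd, Finset.prod_Icc_succ_top (by omega), ← h1]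
        by_cases hB : ω ∈ B (t + 1) <;> simp [Set.mulIndicator, hB, h]
      rcases le_or_gt c (frozenProd c B X (t + 1) ω) with h3 | h3
      · exact Or.inl h3
      · refine Or.inr ⟨e, fun r hr => ?_⟩
        rw [Finset.mem_Icc] at hr
        rcases hr.2.lt_or_eq with h4 | h4
        · exact h2 r (Finset.mem_Icc.2 ⟨hr.1, by omega⟩)
        · rw [h4, ← e]; exact h3

theorem measurable_mulIndicator {Ω : Type*} {m : MeasurableSpace Ω} {X : Ω → ENNReal}
    {S : Set Ω} (hX : Measurable X) (hS : MeasurableSet S) : Measurable (S.mulIndicator X) := by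
  classical
  rw [← Set.piecewise_eq_mulIndicator]
  exact hX.piecewise hS measurable_const

/-- One martingale step: on `S` the independent factor of mean one integrates out, and off `S` the
factor is `1`. -/
theorem lintegral_mul_mulIndicator {Ω : Type*} {m mΩ : MeasurableSpace Ω} {P : Measure Ω}
    (hm : m ≤ mΩ) {N X : Ω → ENNReal} {S : Set Ω}
    (hN : Measurable[m] N) (hS : MeasurableSet[m] S) (hX : Measurable X)
    (hX1 : ∫⁻ ω, X ω ∂P = 1) (hind : Indep (MeasurableSpace.comap X inferInstance) m P) :
    ∫⁻ ω, N ω * S.mulIndicator X ω ∂P = ∫⁻ ω, N ω ∂P := by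
  have h1 : ∀ ω, N ω * S.mulIndicator X ω = S.indicator N ω * X ω + Sᶜ.indicator N ω := by
    intro ω
    by_cases h : ω ∈ S <;> simp [h]
  have hSN : Measurable[m] (S.indicator N) := hN.indicator hS
  have hSN' : Measurable (S.indicator N) := hSN.mono hm le_rfl
  simp_rw [h1]
  rw [lintegral_add_left (f := fun ω => S.indicator N ω * X ω) (hSN'.mul hX),
    lintegral_mul_eq_lintegral_mul_lintegral_of_independent_measurableSpace hm hX.comap_le
    hind.symm hSN (comap_measurable X), hX1, mul_one, ← lintegral_add_left hSN']
  exact lintegral_congr fun ω => Set.indicator_self_add_compl_apply S N ω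

/-- Ville's inequality: the frozen product keeps integral one, and Markov's inequality at time `T`
alone controls all earlier times. -/
theorem measure_exists_le_prod_le {Ω : Type*} [mΩ : MeasurableSpace Ω] {P : Measure Ω}
    [IsProbabilityMeasure P] (ℱ : Filtration ℕ mΩ) {T : ℕ} {X : ℕ → Ω → ENNReal}
    {B : ℕ → Set Ω} (hX : ∀ t ∈ Finset.Icc 1 T, Measurable[ℱ t] (X t))
    (hX1 : ∀ t ∈ Finset.Icc 1 T, ∫⁻ ω, X t ω ∂P = 1)
    (hind : ∀ t ∈ Finset.Icc 1 T,
      Indep (MeasurableSpace.comap (X t) inferInstance) (ℱ (t - 1)) P)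
    (hB : ∀ t ∈ Finset.Icc 1 T, MeasurableSet[ℱ (t - 1)] (B t))
    {c : ENNReal} (hc : c ≠ 0) (hc' : c ≠ ⊤) :
    P {ω | ∃ t ∈ Finset.Icc 1 T, c ≤ ∏ s ∈ Finset.Icc 1 t, (B s).mulIndicator (X s) ω} ≤
      1 / c := by
  have key : ∀ t ≤ T, Measurable[ℱ t] (frozenProd c B X t) ∧
      ∫⁻ ω, frozenProd c B X t ω ∂P = 1 := by
    intro t
    induction t with
    | zero => intro _; exact ⟨measurable_const, by simp [frozenProd]⟩
    | succ t ih =>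
      intro ht
      obtain ⟨h1, h2⟩ := ih (by omega)
      have hmem : t + 1 ∈ Finset.Icc 1 T := Finset.mem_Icc.2 ⟨by omega, ht⟩
      have hS : MeasurableSet[ℱ t] (B (t + 1) ∩ {ω | frozenProd c B X t ω < c}) :=
        (hB _ hmem).inter (h1 measurableSet_Iio)
      have hle : ℱ t ≤ ℱ (t + 1) := ℱ.mono (Nat.le_succ t)
      refine ⟨?_, ?_⟩
      · exact (h1.mono hle le_rfl).mul (measurable_mulIndicator (hX _ hmem) (hle _ hS))
      · rw [← h2]
        exact lintegral_mul_mulIndicator (ℱ.le t) h1 hS (Measurable.mono (hX _ hmem) (ℱ.le _) le_rfl)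
          (hX1 _ hmem) (hind _ hmem)
  obtain ⟨h1, h2⟩ := key T le_rfl
  calc _ ≤ P {ω | c ≤ frozenProd c B X T ω} := by
        refine measure_mono fun ω ⟨t, ht, hle⟩ => ?_
        exact (le_frozenProd_or c B X ω T).resolve_right fun h => (h.2 t ht).not_ge hle
    _ ≤ (∫⁻ ω, frozenProd c B X T ω ∂P) / c :=
        meas_ge_le_lintegral_div (h1.mono (ℱ.le T) le_rfl).aemeasurable hc hc'
    _ = 1 / c := by rw [h2]

/-! ### Deviations of the noise of one arm -/

/-- The sum of the scaled noises of arm `a` over the rounds `1, …, t`. -/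
def noiseSum {Ω : Type*} {K : ℕ} (ξ : ℕ → Ω → ℝ) (A : ℕ → Ω → Fin K) (a : Fin K) (t : ℕ)
    (ω : Ω) : ℝ :=
  ∑ s ∈ (Finset.Icc 1 t).filter (fun s => A s ω = a), ξ s ω

theorem prod_mulIndicator_exp {Ω : Type*} {K : ℕ} (ξ : ℕ → Ω → ℝ) (A : ℕ → Ω → Fin K)
    (a : Fin K) (θ : ℝ) (t : ℕ) (ω : Ω) :
    ∏ s ∈ Finset.Icc 1 t, {ω | A s ω = a}.mulIndicator
        (fun ω => ENNReal.ofReal (Real.exp (θ * ξ s ω - θ ^ 2 / 2))) ω =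
      ENNReal.ofReal (Real.exp (θ * noiseSum ξ A a t ω - θ ^ 2 / 2 * pulls A a t ω)) := by
  have h : θ * noiseSum ξ A a t ω - θ ^ 2 / 2 * pulls A a t ω =
      ∑ s ∈ (Finset.Icc 1 t).filter (fun s => A s ω = a), (θ * ξ s ω - θ ^ 2 / 2) := by
    rw [Finset.sum_sub_distrib, ← Finset.mul_sum, Finset.sum_const, nsmul_eq_mul, noiseSum, pulls]
    ring
  rw [h, Real.exp_sum, ENNReal.ofReal_prod_of_nonneg fun _ _ => (Real.exp_pos _).le,
    Finset.prod_filter]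
  refine Finset.prod_congr rfl fun s _ => ?_
  simp [Set.mulIndicator]

theorem lintegral_exp_gaussian {Ω : Type*} [MeasurableSpace Ω] {P : Measure Ω} {X : Ω → ℝ}
    (hX : Measurable X) (hlaw : P.map X = gaussianReal 0 1) (θ : ℝ) :
    ∫⁻ ω, ENNReal.ofReal (Real.exp (θ * X ω - θ ^ 2 / 2)) ∂P = 1 := by
  have h1 : ∫⁻ ω, ENNReal.ofReal (Real.exp (θ * X ω - θ ^ 2 / 2)) ∂P =
      ∫⁻ x, ENNReal.ofReal (Real.exp (θ * x - θ ^ 2 / 2)) ∂(gaussianReal 0 1) := by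
    rw [← hlaw, lintegral_map (by fun_prop) hX]
  have e : ∀ x : ℝ, Real.exp (θ * x - θ ^ 2 / 2) = Real.exp (-(θ ^ 2 / 2)) * Real.exp (θ * x) := by
    intro x
    rw [← Real.exp_add]
    ring_nf
  have hint : Integrable (fun x : ℝ => Real.exp (θ * x)) (gaussianReal 0 1) :=
    integrable_exp_mul_gaussianReal θ
  have hm : ∫ x, Real.exp (θ * x) ∂(gaussianReal 0 1) = Real.exp (θ ^ 2 / 2) := by
    have := congrFun (mgf_id_gaussianReal (μ := 0) (v := 1)) θ
    simpa [mgf] using this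
  rw [h1, ← ofReal_integral_eq_lintegral_ofReal]
  · simp_rw [e]
    rw [integral_const_mul, hm, ← Real.exp_add]
    simp
  · simp_rw [e]
    exact hint.const_mul _
  · exact Filter.Eventually.of_forall fun x => (Real.exp_pos _).le

section Deviation

variable {Ω : Type*} [mΩ : MeasurableSpace Ω] {P : Measure Ω} [IsProbabilityMeasure P]
  {ℱ : Filtration ℕ mΩ} {K T : ℕ} {ξ : ℕ → Ω → ℝ} {A : ℕ → Ω → Fin K}

/-- The exponential martingale with tilt `θ`, multiplied only over the rounds that pull `a`; that
selection is predictable. -/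
theorem IsBanditRun.measureReal_exists_le_mul_noiseSum (h : IsBanditRun P ℱ T ξ A) (a : Fin K)
    (θ x : ℝ) :
    P.real {ω | ∃ t ∈ Finset.Icc 1 T,
      x ≤ θ * noiseSum ξ A a t ω - θ ^ 2 / 2 * pulls A a t ω} ≤ Real.exp (-x) := by
  have hg : Measurable fun x : ℝ => ENNReal.ofReal (Real.exp (θ * x - θ ^ 2 / 2)) := by fun_prop
  have hcomap : ∀ t, MeasurableSpace.comap
      (fun ω => ENNReal.ofReal (Real.exp (θ * ξ t ω - θ ^ 2 / 2))) inferInstance ≤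
      MeasurableSpace.comap (ξ t) inferInstance := by
    intro t
    exact (hg.comp (comap_measurable (ξ t))).comap_le
  have key := measure_exists_le_prod_le (P := P) ℱ (T := T)
    (X := fun t ω => ENNReal.ofReal (Real.exp (θ * ξ t ω - θ ^ 2 / 2)))
    (B := fun t => {ω | A t ω = a})
    (fun t ht => hg.comp (h.noise_measurable t ht))
    (fun t ht => lintegral_exp_gaussian ((h.noise_measurable t ht).mono (ℱ.le t) le_rfl)
      (h.noise_law t ht) θ)
    (fun t ht => indep_of_indep_of_le_left (h.noise_indep t ht) (hcomap t))
    (fun t ht => h.arm_measurable t ht (measurableSet_singleton a))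
    (c := ENNReal.ofReal (Real.exp x)) (by simp [Real.exp_pos]) ENNReal.ofReal_ne_top
  simp_rw [prod_mulIndicator_exp] at key
  simp only [ENNReal.ofReal_le_ofReal_iff (Real.exp_pos _).le, Real.exp_le_exp] at key
  refine ENNReal.toReal_le_of_le_ofReal (Real.exp_pos _).le (key.trans_eq ?_)
  rw [Real.exp_neg, ENNReal.ofReal_inv_of_pos (Real.exp_pos x), one_div]

/-- The noise of an arm after exactly `m` pulls has Gaussian tails. -/
theorem IsBanditRun.measureReal_exists_pulls_eq (h : IsBanditRun P ℱ T ξ A) (a : Fin K)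
    {m : ℕ} (hm : 0 < m) {y : ℝ} (hy : 0 ≤ y) :
    P.real {ω | ∃ t ∈ Finset.Icc 1 T, pulls A a t ω = m ∧ √m * y ≤ noiseSum ξ A a t ω} ≤
      Real.exp (-(y ^ 2 / 2)) := by
  refine le_trans (measureReal_mono ?_) (h.measureReal_exists_le_mul_noiseSum a (y / √m) (y ^ 2 / 2))
  rintro ω ⟨t, ht, hp, hs⟩
  refine ⟨t, ht, ?_⟩
  have hm' : (0 : ℝ) < √m := Real.sqrt_pos.2 (by exact_mod_cast hm)
  have h1 : y / √m * (√m * y) ≤ y / √m * noiseSum ξ A a t ω := by gcongr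
  have h2 : y / √m * (√m * y) = y ^ 2 := by field_simp
  have h3 : (y / √m) ^ 2 / 2 * m = y ^ 2 / 2 := by
    rw [div_pow, Real.sq_sqrt (Nat.cast_nonneg m)]
    field_simp
  rw [hp, h3]
  linarith

/-- A finite law of the iterated logarithm for the noise of an arm, on the side of `ε = ± 1`. -/
theorem IsBanditRun.measureReal_exists_sqrt_pulls_le (h : IsBanditRun P ℱ T ξ A) (a : Fin K)
    (hT : 1 ≤ Real.log T) {ε : ℝ} (hε : ε ^ 2 = 1) {γ : ℝ} (hγ : 1 ≤ γ) :
    P.real {ω | ∃ t ∈ Finset.Icc 1 T, 0 < pulls A a t ω ∧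
      γ * √(pulls A a t ω) ≤ ε * noiseSum ξ A a t ω} ≤
      4 * (Real.log T * (γ * Real.exp (-γ ^ 2 / 2))) := by
  -- Peeling: `√n` is located between consecutive powers of `q`, one tilt per power. A ratio this
  -- fine leaves the tilt off by a bounded amount, and about `γ log T` powers suffice.
  set q : ℝ := 1 + 1 / γ with hq
  have hγ0 : 0 < γ := by linarith
  have hq1 : 1 < q := by rw [hq]; linarith [one_div_pos.2 hγ0]
  have hq0 : 0 < q := by linarith
  set L : ℕ := ⌊γ * Real.log T⌋₊ with hL
  have hT0 : (0 : ℝ) < T := by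
    rcases Nat.eq_zero_or_pos T with h0 | h0
    · norm_num [h0] at hT
    · exact_mod_cast h0
  calc _ ≤ P.real (⋃ k ∈ Finset.range (L + 1), {ω | ∃ t ∈ Finset.Icc 1 T,
          γ ^ 2 / 2 - 1 / 2 ≤ (ε * (γ / q ^ k)) * noiseSum ξ A a t ω -
            (ε * (γ / q ^ k)) ^ 2 / 2 * pulls A a t ω}) := by
        refine measureReal_mono ?_ (measure_ne_top _ _)
        rintro ω ⟨t, ht, hp, hs⟩
        have hn1 : (1 : ℝ) ≤ pulls A a t ω := by exact_mod_cast hp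
        have hnT : (pulls A a t ω : ℝ) ≤ T := by
          have h1 : pulls A a t ω ≤ t := by
            simpa [pulls] using Finset.card_filter_le (Finset.Icc 1 t) (fun s => A s ω = a)
          exact_mod_cast h1.trans (Finset.mem_Icc.1 ht).2
        set n : ℝ := (pulls A a t ω : ℝ)
        have hsn : 1 ≤ √n := Real.one_le_sqrt.2 hn1
        obtain ⟨k, hk1, hk2⟩ := exists_nat_pow_near hsn hq1
        have hqk : 0 < q ^ k := by positivity
        simp only [Set.mem_iUnion, Finset.mem_range]
        refine ⟨k, ?_, t, ht, ?_⟩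
        · have h1 : (k : ℝ) * Real.log q ≤ 1 / 2 * Real.log T := by
            have := Real.log_le_log hqk hk1
            rw [Real.log_pow, Real.log_sqrt (by linarith)] at this
            have := Real.log_le_log (by linarith) hnT
            linarith
          have h2 : 1 / (2 * γ) ≤ Real.log q := by
            have h3 := Real.one_sub_inv_le_log_of_pos hq0
            have h4 : 1 / (2 * γ) ≤ 1 - q⁻¹ := by
              have : q⁻¹ = γ / (γ + 1) := by rw [hq]; field_simp
              rw [this, one_sub_div (by positivity), add_sub_cancel_left]
              exact one_div_le_one_div_of_le (by positivity) (by linarith)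
            linarith
          have h5 : (k : ℝ) * (1 / (2 * γ)) ≤ 1 / 2 * Real.log T :=
            le_trans (by gcongr) h1
          have h6 : (k : ℝ) ≤ γ * Real.log T := by
            have := mul_le_mul_of_nonneg_left h5 (by positivity : 0 ≤ 2 * γ)
            field_simp at this
            linarith
          exact Nat.lt_succ_of_le (Nat.le_floor h6)
        · set x : ℝ := γ / q ^ k * √n with hx
          have hx1 : γ ≤ x := by
            rw [hx, div_mul_eq_mul_div, le_div_iff₀ hqk]
            gcongr
          have hx2 : x ≤ γ + 1 := by
            have : γ + 1 = γ * q := by rw [hq]; field_simp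
            rw [this, hx, div_mul_eq_mul_div, div_le_iff₀ hqk, mul_assoc]
            have : q * q ^ k = q ^ (k + 1) := by ring
            rw [this]
            gcongr
          have e1 : (ε * (γ / q ^ k)) ^ 2 / 2 * n = x ^ 2 / 2 := by
            rw [mul_pow, hε, hx, mul_pow, Real.sq_sqrt (by linarith)]
            ring
          have e2 : x * γ ≤ (ε * (γ / q ^ k)) * noiseSum ξ A a t ω := by
            calc x * γ = γ / q ^ k * (γ * √n) := by rw [hx]; ring
              _ ≤ γ / q ^ k * (ε * noiseSum ξ A a t ω) := by gcongr
              _ = _ := by ring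
          rw [e1]
          -- Uses `x * γ - x ^ 2 / 2 = γ ^ 2 / 2 - (x - γ) ^ 2 / 2` with `0 ≤ x - γ ≤ 1`: the
          -- mismatch costs only a factor `exp (1 / 2)`.
          nlinarith
    _ ≤ ∑ k ∈ Finset.range (L + 1), Real.exp (-(γ ^ 2 / 2 - 1 / 2)) := by
        refine (measureReal_biUnion_finset_le _ _).trans (Finset.sum_le_sum fun k _ => ?_)
        exact h.measureReal_exists_le_mul_noiseSum a _ _
    _ = (L + 1) * (Real.exp (1 / 2) * Real.exp (-γ ^ 2 / 2)) := by
        rw [Finset.sum_const, Finset.card_range, nsmul_eq_mul, ← Real.exp_add]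
        push_cast
        ring_nf
    _ ≤ (2 * (γ * Real.log T)) * (2 * Real.exp (-γ ^ 2 / 2)) := by
        have h1 : (L : ℝ) ≤ γ * Real.log T := Nat.floor_le (by positivity)
        have h2 : 1 ≤ γ * Real.log T := one_le_mul_of_one_le_of_one_le hγ hT
        have h3 : Real.exp (1 / 2) ≤ 2 := by
          have := Real.exp_one_lt_d9
          have e : Real.exp (1 / 2) ^ 2 = Real.exp 1 := by
            rw [← Real.exp_nat_mul]; norm_num
          nlinarith [Real.exp_pos (1 / 2)]
        gcongr
        linarith
    _ = _ := by ring

end Deviation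

/-- Markov's inequality for a weighted count of events, measurable or not. -/
theorem measureReal_le_sum_indicator_le {Ω ι : Type*} [MeasurableSpace Ω] {P : Measure Ω}
    [IsFiniteMeasure P] (I : Finset ι) (c : ι → ℝ) (hc : ∀ i ∈ I, 0 ≤ c i) (s : ι → Set Ω)
    {x : ℝ} (hx : 0 < x) :
    P.real {ω | x ≤ ∑ i ∈ I, c i * (s i).indicator 1 ω} ≤ (∑ i ∈ I, c i * P.real (s i)) / x := by
  -- Measurable hulls have the same measure and only enlarge the count.
  set f : Ω → ℝ := fun ω => ∑ i ∈ I, c i * (toMeasurable P (s i)).indicator 1 ω with hf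
  have hi : ∀ i, Integrable ((toMeasurable P (s i)).indicator (1 : Ω → ℝ)) P := fun i =>
    (integrable_const (1 : ℝ)).indicator (measurableSet_toMeasurable P (s i))
  have h1 : ∫ ω, f ω ∂P = ∑ i ∈ I, c i * P.real (s i) := by
    rw [hf, integral_finsetSum _ fun i _ => (hi i).const_mul _]
    refine Finset.sum_congr rfl fun i _ => ?_
    rw [integral_const_mul, integral_indicator_one (measurableSet_toMeasurable P (s i)),
      measureReal_def, measure_toMeasurable, measureReal_def]
  have hnn : 0 ≤ᵐ[P] f := Filter.Eventually.of_forall fun ω =>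
    Finset.sum_nonneg fun i hi => mul_nonneg (hc i hi)
      (Set.indicator_nonneg (fun _ _ => zero_le_one) _)
  have h2 := mul_meas_ge_le_integral_of_nonneg hnn
    (integrable_finsetSum _ fun i _ => (hi i).const_mul _) x
  rw [h1] at h2
  rw [le_div_iff₀ hx, mul_comm]
  refine le_trans ?_ h2
  refine mul_le_mul_of_nonneg_left (measureReal_mono (fun ω hω => ?_) (measure_ne_top _ _)) hx.le
  refine le_trans (Set.mem_ofPred.1 hω) (Finset.sum_le_sum fun i hi => ?_)
  refine mul_le_mul_of_nonneg_left ?_ (hc i hi)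
  exact Set.indicator_le_indicator_of_subset (f := (1 : Ω → ℝ)) (subset_toMeasurable P (s i))
    (fun _ => zero_le_one) ω

/-! ### Counting pulls -/

section Pulls

variable {Ω : Type*} {K T : ℕ} {A : ℕ → Ω → Fin K}

theorem pulls_succ (A : ℕ → Ω → Fin K) (a : Fin K) (t : ℕ) (ω : Ω) :
    pulls A a (t + 1) ω = pulls A a t ω + if A (t + 1) ω = a then 1 else 0 := by
  have h : Finset.Icc 1 (t + 1) = insert (t + 1) (Finset.Icc 1 t) := by
    ext s; simp only [Finset.mem_Icc, Finset.mem_insert]; omega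
  rw [pulls, pulls, h, Finset.filter_insert]
  split_ifs with h1
  · rw [Finset.card_insert_of_notMem (by simp)]
  · rfl

theorem pulls_mono (A : ℕ → Ω → Fin K) (a : Fin K) (ω : Ω) : Monotone (fun t => pulls A a t ω) :=
  monotone_nat_of_le_succ fun t => by rw [pulls_succ]; omega

theorem sum_pulls (A : ℕ → Ω → Fin K) (t : ℕ) (ω : Ω) : ∑ a, pulls A a t ω = t := by
  simpa [pulls] using (Finset.card_eq_sum_card_fiberwise (f := fun s => A s ω)
    (s := Finset.Icc 1 t) (t := Finset.univ) (by simp [Set.MapsTo])).symm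

theorem pulls_le (A : ℕ → Ω → Fin K) (a : Fin K) (t : ℕ) (ω : Ω) : pulls A a t ω ≤ t := by
  simpa [pulls] using Finset.card_filter_le (Finset.Icc 1 t) (fun s => A s ω = a)

/-- The count climbs by unit steps from `1` at time `K`; `t` is the time just before pull number `m
+ 1`. -/
theorem exists_pull_of_lt {a : Fin K} {ω : Ω} (hK : pulls A a K ω = 1) (hKT : K ≤ T) {m : ℕ}
    (hm : 1 ≤ m) (hmT : m < pulls A a T ω) :
    ∃ t ∈ Finset.Ico K T, A (t + 1) ω = a ∧ pulls A a t ω = m := by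
  induction T, hKT using Nat.le_induction with
  | base => omega
  | succ t ht ih =>
    by_cases h : m < pulls A a t ω
    · obtain ⟨s, hs, h1⟩ := ih h
      rw [Finset.mem_Ico] at hs
      exact ⟨s, Finset.mem_Ico.2 ⟨hs.1, by omega⟩, h1⟩
    · rw [pulls_succ] at hmT
      split_ifs at hmT with h1
      · exact ⟨t, Finset.mem_Ico.2 ⟨ht, by omega⟩, h1, by omega⟩
      · omega

end Pulls

/-! ### The index of an arm compared with a level -/

section Index

variable {Ω : Type*} {K T : ℕ} {μ : Fin K → ℝ} {σ γT : ℝ} {ξ : ℕ → Ω → ℝ} {A : ℕ → Ω → Fin K}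

theorem empMean_eq {a : Fin K} {t : ℕ} {ω : Ω} (hn : 0 < pulls A a t ω) :
    empMean μ σ ξ A a t ω = μ a + σ * noiseSum ξ A a t ω / pulls A a t ω := by
  have h : ∑ s ∈ (Finset.Icc 1 t).filter (fun s => A s ω = a), reward μ σ ξ A s ω =
      pulls A a t ω * μ a + σ * noiseSum ξ A a t ω := by
    rw [noiseSum, Finset.mul_sum, pulls, ← nsmul_eq_mul, ← Finset.sum_const,
      ← Finset.sum_add_distrib]
    refine Finset.sum_congr rfl fun s hs => ?_
    rw [reward, (Finset.mem_filter.1 hs).2]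
  have hn' : (0 : ℝ) < pulls A a t ω := by exact_mod_cast hn
  rw [empMean, h]
  field_simp

/-- Multiplying by `n / σ` isolates the noise, so that tail bounds on it translate into bounds on `n
/ ν`. -/
theorem ucbIndex_le_iff (hσ : 0 < σ) {a : Fin K} {t : ℕ} {ω : Ω} (hn : 0 < pulls A a t ω)
    {ν : ℝ} (hν : 0 < ν) :
    ucbIndex μ σ γT ξ A a t ω ≤ μ a + σ * γT / √ν ↔
      noiseSum ξ A a t ω ≤ √(pulls A a t ω) * (γT * (√(pulls A a t ω) / √ν - 1)) := by
  have hn' : (0 : ℝ) < pulls A a t ω := by exact_mod_cast hn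
  rw [ucbIndex, empMean_eq hn]
  set n : ℝ := (pulls A a t ω : ℝ)
  have hs : 0 < √n := Real.sqrt_pos.2 hn'
  have hv : 0 < √ν := Real.sqrt_pos.2 hν
  have hsq : √n ^ 2 = n := Real.sq_sqrt hn'.le
  rw [add_assoc, add_le_add_iff_left]
  have e1 : σ * noiseSum ξ A a t ω / n + σ * γT / √n =
      σ / n * (noiseSum ξ A a t ω + γT * √n) := by
    field_simp
    linear_combination -γT * hsq
  have e2 : σ * γT / √ν = σ / n * (γT * n / √ν) := by field_simp
  have e3 : √n * (γT * (√n / √ν - 1)) = γT * n / √ν - γT * √n := by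
    nth_rewrite 3 [← hsq]
    field_simp
  rw [e1, e2, e3, mul_le_mul_iff_right₀ (by positivity), le_sub_iff_add_le]

theorem mul_le_pulls_of_ucbIndex_le (hσ : 0 < σ) (hγ : 0 < γT) {a : Fin K} {t : ℕ} {ω : Ω}
    (hn : 0 < pulls A a t ω) {ν η : ℝ} (hν : 0 < ν) (hη : η ≤ 1)
    (h : ucbIndex μ σ γT ξ A a t ω ≤ μ a + σ * γT / √ν)
    (hξ : -noiseSum ξ A a t ω ≤ η * γT * √(pulls A a t ω)) :
    (1 - η) ^ 2 * ν ≤ pulls A a t ω := by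
  have hn' : (0 : ℝ) < pulls A a t ω := by exact_mod_cast hn
  rw [ucbIndex_le_iff hσ hn hν] at h
  set n : ℝ := (pulls A a t ω : ℝ)
  have hs : 0 < √n := Real.sqrt_pos.2 hn'
  have hv : 0 < √ν := Real.sqrt_pos.2 hν
  have h1 : √n * γT * (1 - η) ≤ √n * γT * (√n / √ν) := by nlinarith
  have h2 : 1 - η ≤ √n / √ν := le_of_mul_le_mul_left h1 (by positivity)
  rw [le_div_iff₀ hv] at h2
  calc (1 - η) ^ 2 * ν = ((1 - η) * √ν) ^ 2 := by rw [mul_pow, Real.sq_sqrt hν.le]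
    _ ≤ √n ^ 2 := by
      refine pow_le_pow_left₀ (mul_nonneg (by linarith) hv.le) h2 2
    _ = n := Real.sq_sqrt hn'.le

theorem pulls_le_of_lt_ucbIndex (hσ : 0 < σ) (hγ : 0 < γT) {a : Fin K} {t : ℕ} {ω : Ω}
    (hn : 0 < pulls A a t ω) {ν η : ℝ} (hν : 0 < ν)
    (h : μ a + σ * γT / √ν < ucbIndex μ σ γT ξ A a t ω)
    (hξ : noiseSum ξ A a t ω ≤ η * γT * √(pulls A a t ω)) :
    (pulls A a t ω : ℝ) ≤ (1 + η) ^ 2 * ν := by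
  have hn' : (0 : ℝ) < pulls A a t ω := by exact_mod_cast hn
  rw [← not_le, ucbIndex_le_iff hσ hn hν, not_le] at h
  set n : ℝ := (pulls A a t ω : ℝ)
  have hs : 0 < √n := Real.sqrt_pos.2 hn'
  have hv : 0 < √ν := Real.sqrt_pos.2 hν
  have h1 : √n * γT * (√n / √ν) ≤ √n * γT * (1 + η) := by nlinarith
  have h2 : √n / √ν ≤ 1 + η := le_of_mul_le_mul_left h1 (by positivity)
  rw [div_le_iff₀ hv] at h2
  calc n = √n ^ 2 := (Real.sq_sqrt hn'.le).symm
    _ ≤ ((1 + η) * √ν) ^ 2 := pow_le_pow_left₀ hs.le h2 2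
    _ = _ := by rw [mul_pow, Real.sq_sqrt hν.le]

/-- If some index always exceeds `ℓ`, then so does that of the arm about to be pulled, being
maximal. -/
theorem IsUCB1.exists_lt_ucbIndex (h : IsUCB1 μ σ γT T ξ A) (hKT : K ≤ T) {ω : Ω} {ℓ : ℝ}
    (hℓ : ¬∃ t ∈ Finset.Ico K T, ∀ b, ucbIndex μ σ γT ξ A b t ω ≤ ℓ) {a : Fin K} {m : ℕ}
    (hm : 1 ≤ m) (hmT : m < pulls A a T ω) :
    ∃ t ∈ Finset.Ico K T, pulls A a t ω = m ∧ ℓ < ucbIndex μ σ γT ξ A a t ω := by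
  obtain ⟨t, ht, h1, h2⟩ := exists_pull_of_lt (h.init ω a) hKT hm hmT
  push Not at hℓ
  obtain ⟨b, hb⟩ := hℓ t ht
  refine ⟨t, ht, h2, hb.trans_le ?_⟩
  rw [Finset.mem_Ico] at ht
  have := h.step (t + 1) (Finset.mem_Icc.2 ⟨by omega, by omega⟩) ω b
  rwa [Nat.add_sub_cancel, h1] at this

theorem IsUCB1.pulls_pos (h : IsUCB1 μ σ γT T ξ A) (a : Fin K) {t : ℕ} (ht : K ≤ t) (ω : Ω) :
    0 < pulls A a t ω := by
  have h1 : pulls A a K ω ≤ pulls A a t ω := pulls_mono A a ω ht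
  rw [h.init ω a] at h1
  omega

end Index

/-! ### The deterministic number of pulls at a perturbed level -/

section Level

variable {K : ℕ} (μ : Fin K → ℝ) (σ γT : ℝ) (T : ℕ)

/-- The elasticity `(n*_{a;T} / n_*) ^ (1 / 2)` of the number of pulls of arm `a`. -/
def armRatio (a : Fin K) : ℝ := √(nStarArm μ σ γT T a / nStar μ σ γT T)

/-- The common index level of the arms when `1 / √n_*` is perturbed by the factor `1 + τ`. -/
def level (τ : ℝ) : ℝ := (⨆ b, μ b) + σ * γT * (1 + τ) / √(nStar μ σ γT T)

/-- The noiseless number of pulls that brings the index of arm `a` to `level τ`. -/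
def levelPulls (τ : ℝ) (a : Fin K) : ℝ :=
  nStarArm μ σ γT T a / (1 + τ * armRatio μ σ γT T a) ^ 2

variable {σ γT T}

theorem pullCurve_eq_sq {n : ℝ} (hn : 0 ≤ n) (a : Fin K) :
    pullCurve μ σ γT n a = (√n / (1 + √n * gap μ a / (σ * γT))) ^ 2 := by
  rw [div_pow, Real.sq_sqrt hn, pullCurve, ← div_eq_mul_inv]

theorem sqrt_mul_gap_div_nonneg (hσ : 0 < σ) (hγ : 0 < γT) (n : ℝ) (a : Fin K) :
    0 ≤ √n * gap μ a / (σ * γT) :=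
  div_nonneg (mul_nonneg (Real.sqrt_nonneg _) (gap_nonneg μ a)) (by positivity)

theorem sum_nStarArm_mul_armRatio (hT : 0 < T) :
    ∑ b, nStarArm μ σ γT T b * armRatio μ σ γT T b = T * DStar μ σ γT T := by
  have hT' : (T : ℝ) ≠ 0 := by exact_mod_cast hT.ne'
  rw [DStar, ← mul_assoc, mul_one_div_cancel hT', one_mul]
  exact Finset.sum_congr rfl fun b _ => mul_comm _ _

variable (hT : 0 < T) (hσ : 0 < σ) (hγ : 0 < γT) (a : Fin K)
include hT hσ hγ

theorem nStar_pos (hK : 0 < K) : 0 < nStar μ σ γT T := (isNStar_nStar hK hT μ hσ hγ).1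

theorem sum_nStarArm (hK : 0 < K) : ∑ b, nStarArm μ σ γT T b = T :=
  (isNStar_nStar hK hT μ hσ hγ).2

theorem nStarArm_pos : 0 < nStarArm μ σ γT T a := by
  have hN := nStar_pos μ hT hσ hγ a.pos
  have hx := sqrt_mul_gap_div_nonneg μ hσ hγ (nStar μ σ γT T) a
  have := Real.sqrt_pos.2 hN
  rw [nStarArm, pullCurve_eq_sq μ hN.le]
  positivity

theorem armRatio_eq : armRatio μ σ γT T a =
    1 / (1 + √(nStar μ σ γT T) * gap μ a / (σ * γT)) := by
  have hN := nStar_pos μ hT hσ hγ a.pos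
  have hx := sqrt_mul_gap_div_nonneg μ hσ hγ (nStar μ σ γT T) a
  rw [armRatio, nStarArm, pullCurve, mul_div_cancel_left₀ _ hN.ne', ← inv_pow,
    Real.sqrt_sq (by positivity), one_div]

theorem armRatio_pos : 0 < armRatio μ σ γT T a := by
  have hx := sqrt_mul_gap_div_nonneg μ hσ hγ (nStar μ σ γT T) a
  rw [armRatio_eq μ hT hσ hγ]
  positivity

theorem armRatio_le_one : armRatio μ σ γT T a ≤ 1 := by
  have hx := sqrt_mul_gap_div_nonneg μ hσ hγ (nStar μ σ γT T) a
  rw [armRatio_eq μ hT hσ hγ]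
  exact div_le_one_of_le₀ (by linarith) (by positivity)

theorem levelPulls_pos {τ : ℝ} (hτ : -1 < τ) : 0 < levelPulls μ σ γT T τ a := by
  have h1 := armRatio_pos μ hT hσ hγ a
  have h2 := armRatio_le_one μ hT hσ hγ a
  have : 0 < 1 + τ * armRatio μ σ γT T a := by nlinarith
  exact div_pos (nStarArm_pos μ hT hσ hγ a) (by positivity)

/-- With `x = √n_* Δ_a / (σ γT)` the elasticity is `1 / (1 + x)`, so `√(levelPulls τ a) = √n_* / (1
+ x + τ)`: in inverse square roots the shift by `τ` is additive and the same for all arms. -/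
theorem level_eq {τ : ℝ} (hτ : -1 < τ) :
    level μ σ γT T τ = μ a + σ * γT / √(levelPulls μ σ γT T τ a) := by
  have hN := nStar_pos μ hT hσ hγ a.pos
  have hx := sqrt_mul_gap_div_nonneg μ hσ hγ (nStar μ σ γT T) a
  have hs := Real.sqrt_pos.2 hN
  have hg : (⨆ b, μ b) = μ a + gap μ a := by simp [gap]
  rw [levelPulls, armRatio_eq μ hT hσ hγ, nStarArm, pullCurve_eq_sq μ hN.le, ← div_pow, level, hg]
  set s := √(nStar μ σ γT T)
  set x := s * gap μ a / (σ * γT) with hxd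
  have hp : 0 < 1 + x + τ := by linarith
  have e : s / (1 + x) / (1 + τ * (1 / (1 + x))) = s / (1 + x + τ) := by
    have : 1 + τ * (1 / (1 + x)) = (1 + x + τ) / (1 + x) := by field_simp
    rw [this]
    field_simp
  rw [e, Real.sqrt_sq (by positivity)]
  have : gap μ a = σ * γT * x / s := by rw [hxd]; field_simp
  rw [this]
  field_simp
  ring

theorem DStar_pos (hK : 0 < K) : 0 < DStar μ σ γT T := by
  have : Nonempty (Fin K) := ⟨⟨0, hK⟩⟩
  have h : 0 < ∑ b, nStarArm μ σ γT T b * armRatio μ σ γT T b :=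
    Finset.sum_pos (fun b _ => mul_pos (nStarArm_pos μ hT hσ hγ b) (armRatio_pos μ hT hσ hγ b))
      Finset.univ_nonempty
  rw [sum_nStarArm_mul_armRatio μ hT] at h
  exact pos_of_mul_pos_right h (Nat.cast_nonneg T)

theorem DStar_le_one (hK : 0 < K) : DStar μ σ γT T ≤ 1 := by
  have hT' : (0 : ℝ) < T := by exact_mod_cast hT
  have h : ∑ b, nStarArm μ σ γT T b * armRatio μ σ γT T b ≤ ∑ b, nStarArm μ σ γT T b :=
    Finset.sum_le_sum fun b _ =>
      mul_le_of_le_one_right (nStarArm_pos μ hT hσ hγ b).le (armRatio_le_one μ hT hσ hγ b)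
  rw [sum_nStarArm_mul_armRatio μ hT, sum_nStarArm μ hT hσ hγ hK] at h
  exact le_of_mul_le_mul_left (by simpa using h) hT'

/-- Termwise `(1 + y)⁻² ≤ 1 - y / 2` on `[0, 1]` with `y = τ * armRatio`; the linear terms add up to
a multiple of `T * D_*`. -/
theorem sum_levelPulls_le (hK : 0 < K) {τ : ℝ} (h0 : 0 ≤ τ) (h1 : τ ≤ 1) :
    ∑ b, levelPulls μ σ γT T τ b ≤ T * (1 - τ * DStar μ σ γT T / 2) := by
  have e : T * (1 - τ * DStar μ σ γT T / 2) =
      ∑ b, nStarArm μ σ γT T b * (1 - τ * armRatio μ σ γT T b / 2) := by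
    have : ∀ b, nStarArm μ σ γT T b * (1 - τ * armRatio μ σ γT T b / 2) =
        nStarArm μ σ γT T b - τ / 2 * (nStarArm μ σ γT T b * armRatio μ σ γT T b) := fun b => by
      ring
    simp_rw [this]
    rw [Finset.sum_sub_distrib, ← Finset.mul_sum, sum_nStarArm_mul_armRatio μ hT,
      sum_nStarArm μ hT hσ hγ hK]
    ring
  rw [e]
  refine Finset.sum_le_sum fun b _ => ?_
  have hu0 := armRatio_pos μ hT hσ hγ b
  have hu1 := armRatio_le_one μ hT hσ hγ b
  have hn := nStarArm_pos μ hT hσ hγ b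
  rw [levelPulls]
  set y := τ * armRatio μ σ γT T b
  have hy0 : 0 ≤ y := by positivity
  have hy1 : y ≤ 1 := mul_le_one₀ h1 hu0.le hu1
  rw [div_le_iff₀ (by positivity), mul_assoc]
  refine le_mul_of_one_le_right hn.le ?_
  nlinarith [pow_le_one₀ (n := 2) hy0 hy1]

/-- The opposite shift, from `(1 - y)⁻² ≥ 1 + 2 * y`. -/
theorem le_sum_levelPulls (hK : 0 < K) {ρ : ℝ} (h0 : 0 ≤ ρ) (h1 : ρ ≤ 1 / 2) :
    T * (1 + 2 * ρ * DStar μ σ γT T) ≤ ∑ b, levelPulls μ σ γT T (-ρ) b := by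
  have e : T * (1 + 2 * ρ * DStar μ σ γT T) =
      ∑ b, nStarArm μ σ γT T b * (1 + 2 * (ρ * armRatio μ σ γT T b)) := by
    have : ∀ b, nStarArm μ σ γT T b * (1 + 2 * (ρ * armRatio μ σ γT T b)) =
        nStarArm μ σ γT T b + 2 * ρ * (nStarArm μ σ γT T b * armRatio μ σ γT T b) := fun b => by
      ring
    simp_rw [this]
    rw [Finset.sum_add_distrib, ← Finset.mul_sum, sum_nStarArm_mul_armRatio μ hT,
      sum_nStarArm μ hT hσ hγ hK]
    ring
  rw [e]
  refine Finset.sum_le_sum fun b _ => ?_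
  have hu0 := armRatio_pos μ hT hσ hγ b
  have hu1 := armRatio_le_one μ hT hσ hγ b
  have hn := nStarArm_pos μ hT hσ hγ b
  rw [levelPulls, neg_mul]
  set y := ρ * armRatio μ σ γT T b
  have hy0 : 0 ≤ y := by positivity
  have hy1 : y ≤ 1 / 2 := (mul_le_of_le_one_right h0 hu1).trans h1
  have : 0 < 1 + -y := by linarith
  rw [le_div_iff₀ (by positivity), mul_assoc]
  refine mul_le_of_le_one_right hn.le ?_
  nlinarith [mul_nonneg (sq_nonneg y) (by linarith : (0 : ℝ) ≤ 3 - 2 * y)]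

theorem levelPulls_neg_le {ρ : ℝ} (h0 : 0 ≤ ρ) (h1 : ρ ≤ 1 / 2) :
    levelPulls μ σ γT T (-ρ) a ≤ nStarArm μ σ γT T a * (1 + 6 * ρ) := by
  have hu0 := armRatio_pos μ hT hσ hγ a
  have hu1 := armRatio_le_one μ hT hσ hγ a
  have hn := nStarArm_pos μ hT hσ hγ a
  rw [levelPulls, neg_mul]
  set y := ρ * armRatio μ σ γT T a
  have hy0 : 0 ≤ y := by positivity
  have hy1 : y ≤ ρ := mul_le_of_le_one_right h0 hu1
  have h2 : (1 - ρ) ^ 2 ≤ (1 + -y) ^ 2 := pow_le_pow_left₀ (by linarith) (by linarith) 2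
  have h3 : 1 ≤ (1 + 6 * ρ) * (1 - ρ) ^ 2 := by
    have : 0 ≤ ρ * ((1 - 2 * ρ) * (4 - 3 * ρ)) :=
      mul_nonneg h0 (mul_nonneg (by linarith) (by linarith))
    nlinarith
  have h4 : (1 + 6 * ρ) * (1 - ρ) ^ 2 ≤ (1 + 6 * ρ) * (1 + -y) ^ 2 := by gcongr
  have : 0 < 1 + -y := by linarith
  rw [div_le_iff₀ (by positivity), mul_assoc]
  exact le_mul_of_one_le_right hn.le (h3.trans h4)

theorem mul_le_levelPulls {τ : ℝ} (h0 : 0 ≤ τ) :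
    nStarArm μ σ γT T a * (1 - 2 * τ) ≤ levelPulls μ σ γT T τ a := by
  have hu0 := armRatio_pos μ hT hσ hγ a
  have hu1 := armRatio_le_one μ hT hσ hγ a
  have hn := nStarArm_pos μ hT hσ hγ a
  rw [levelPulls]
  set y := τ * armRatio μ σ γT T a
  have hy0 : 0 ≤ y := by positivity
  have hy1 : y ≤ τ := mul_le_of_le_one_right h0 hu1
  rw [le_div_iff₀ (by positivity), mul_assoc]
  refine mul_le_of_le_one_right hn.le ?_
  have : (1 - 2 * τ) * (1 + y) ^ 2 ≤ (1 - 2 * y) * (1 + y) ^ 2 := by gcongr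
  nlinarith [pow_nonneg hy0 3, sq_nonneg y]

/-- `1 / √n*_a = 1 / √n_* + Δ_a / (σ γT)`, and `n_* ≥ T / K` because no `n*_b` exceeds `n_*`. This
prices a single extra pull and explains the gap term in `err`. -/
theorem inv_nStarArm_le :
    1 / nStarArm μ σ γT T a ≤ 2 * ((K : ℝ) / T + ‖fun b => gap μ b / σ‖ ^ 2 / γT ^ 2) := by
  have hN := nStar_pos μ hT hσ hγ a.pos
  have hs := Real.sqrt_pos.2 hN
  have hT' : (0 : ℝ) < T := by exact_mod_cast hT
  have h1 : 1 / nStar μ σ γT T ≤ (K : ℝ) / T := by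
    rw [div_le_div_iff₀ hN hT', one_mul, ← sum_nStarArm μ hT hσ hγ a.pos]
    have : ∀ b ∈ Finset.univ, nStarArm μ σ γT T b ≤ nStar μ σ γT T := by
      intro b _
      rw [nStarArm, pullCurve]
      refine mul_le_of_le_one_right hN.le (inv_le_one_of_one_le₀ (one_le_pow₀ ?_))
      linarith [sqrt_mul_gap_div_nonneg μ hσ hγ (nStar μ σ γT T) b]
    simpa using Finset.sum_le_card_nsmul _ _ _ this
  have h2 : (gap μ a / σ / γT) ^ 2 ≤ ‖fun b => gap μ b / σ‖ ^ 2 / γT ^ 2 := by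
    rw [div_pow]
    have h3 : 0 ≤ gap μ a / σ := div_nonneg (gap_nonneg μ a) hσ.le
    have h4 : gap μ a / σ ≤ ‖fun b => gap μ b / σ‖ :=
      (le_abs_self _).trans (norm_le_pi_norm (fun b => gap μ b / σ) a)
    gcongr
  have e : 1 / nStarArm μ σ γT T a = (1 / √(nStar μ σ γT T) + gap μ a / σ / γT) ^ 2 := by
    rw [nStarArm, pullCurve_eq_sq μ hN.le, ← one_div_pow, one_div_div]
    congr 1
    field_simp
  have e2 : (1 / √(nStar μ σ γT T)) ^ 2 = 1 / nStar μ σ γT T := by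
    rw [div_pow, Real.sq_sqrt hN.le, one_pow]
  rw [e]
  nlinarith [sq_nonneg (1 / √(nStar μ σ γT T) - gap μ a / σ / γT)]

end Level

/-! ### The level of the indices at the horizon -/

section Run

variable {Ω : Type*} {K T : ℕ} {μ : Fin K → ℝ} {σ γT : ℝ} {ξ : ℕ → Ω → ℝ} {A : ℕ → Ω → Fin K}

/-- The event that after exactly `m` pulls the noise lifts the index of arm `a` to the level
that it would reach without noise after `ν` pulls. -/
def excessEvent (T : ℕ) (γT : ℝ) (ξ : ℕ → Ω → ℝ) (A : ℕ → Ω → Fin K) (a : Fin K) (ν : ℝ)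
    (m : ℕ) : Set Ω :=
  {ω | ∃ t ∈ Finset.Icc 1 T, pulls A a t ω = m ∧
    √m * (γT * (√m / √ν - 1)) ≤ noiseSum ξ A a t ω}

/-- Each `m` from `1` to `n_{a;T} - 1` is the count just before a pull made above the level, so `m`
is either at most `(1 + η) ^ 2 * ν` or an excess. -/
theorem IsUCB1.pulls_le_add_sum_excessEvent (h : IsUCB1 μ σ γT T ξ A) (hσ : 0 < σ) (hKT : K ≤ T)
    {ω : Ω} {a : Fin K} {ν η : ℝ} (hν : 0 < ν)
    (hℓ : ¬∃ t ∈ Finset.Ico K T, ∀ b, ucbIndex μ σ γT ξ A b t ω ≤ μ a + σ * γT / √ν) :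
    (pulls A a T ω : ℝ) ≤ 1 + (1 + η) ^ 2 * ν +
      ∑ m ∈ Finset.Ioo ⌊(1 + η) ^ 2 * ν⌋₊ (T + 1),
        1 * (excessEvent T γT ξ A a ν m).indicator 1 ω := by
  classical
  set k := ⌊(1 + η) ^ 2 * ν⌋₊ with hk
  have hk' : (k : ℝ) ≤ (1 + η) ^ 2 * ν := Nat.floor_le (by positivity)
  set I := (Finset.Ioo k (T + 1)).filter (fun m => ω ∈ excessEvent T γT ξ A a ν m)
  have hsum : ∑ m ∈ Finset.Ioo k (T + 1), 1 * (excessEvent T γT ξ A a ν m).indicator 1 ω =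
      (I.card : ℝ) := by
    simp [I, Set.indicator_apply]
  have hsub : Finset.Icc 1 (pulls A a T ω - 1) ⊆ Finset.Icc 1 k ∪ I := by
    intro m hm
    rw [Finset.mem_Icc] at hm
    have hT := pulls_le A a T ω
    rw [Finset.mem_union, Finset.mem_Icc, Finset.mem_filter, Finset.mem_Ioo]
    rcases le_or_gt m k with h1 | h1
    · exact Or.inl ⟨hm.1, h1⟩
    · refine Or.inr ⟨⟨h1, by omega⟩, ?_⟩
      obtain ⟨t, ht, h2, h3⟩ := h.exists_lt_ucbIndex hKT hℓ hm.1 (by omega : m < pulls A a T ω)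
      rw [Finset.mem_Ico] at ht
      have hK := a.pos
      refine ⟨t, Finset.mem_Icc.2 ⟨by omega, by omega⟩, h2, ?_⟩
      rw [← not_le, ucbIndex_le_iff hσ (by omega) hν, not_le, h2] at h3
      exact h3.le
  have hcard := (Finset.card_le_card hsub).trans (Finset.card_union_le _ _)
  simp only [Nat.card_Icc] at hcard
  have h4 : pulls A a T ω ≤ 1 + k + I.card := by omega
  rw [hsum]
  have h5 : (pulls A a T ω : ℝ) ≤ 1 + k + I.card := by exact_mod_cast h4
  linarith

variable [mΩ : MeasurableSpace Ω] {P : Measure Ω} [IsProbabilityMeasure P] {ℱ : Filtration ℕ mΩ}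

/-- Applied with `v = √(m / ν)`, this turns a Gaussian tail into `m⁻²`, which is summable over pull
counts. -/
theorem exp_neg_le_div_pow_four {v : ℝ} : Real.exp (-(4 * (v - 1) ^ 2)) * v ^ 4 ≤ 4 := by
  set z := 2 * (v - 1) ^ 2 with hz
  have hz0 : 0 ≤ z := by positivity
  have h1 : v ^ 2 ≤ 2 * Real.exp z := by
    have := Real.add_one_le_exp z
    nlinarith [sq_nonneg (v - 2)]
  have h2 : v ^ 4 ≤ 4 * Real.exp (2 * z) := by
    calc v ^ 4 = (v ^ 2) ^ 2 := by ring
      _ ≤ (2 * Real.exp z) ^ 2 := pow_le_pow_left₀ (sq_nonneg v) h1 2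
      _ = 4 * Real.exp (2 * z) := by rw [mul_pow, ← Real.exp_nat_mul]; norm_num
  have e : -(4 * (v - 1) ^ 2) = -(2 * z) := by rw [hz]; ring
  rw [e]
  calc _ ≤ Real.exp (-(2 * z)) * (4 * Real.exp (2 * z)) := by gcongr
    _ = 4 := by rw [mul_left_comm, ← Real.exp_add]; simp

/-- The threshold `γT * (v - 1)` is at least `η * γT` and at least `4 * (v - 1)`. Half of the
exponent gives the small prefactor, the other half the decay in `m`. -/
theorem IsBanditRun.measureReal_excessEvent_le (h : IsBanditRun P ℱ T ξ A) (hγ : 4 ≤ γT)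
    (a : Fin K) {ν η : ℝ} (hν : 0 < ν) (hη : 0 < η) {m : ℕ} (hm : (1 + η) ^ 2 * ν ≤ m) :
    P.real (excessEvent T γT ξ A a ν m) ≤
      4 * Real.exp (-((η * γT) ^ 2 / 4)) * ν ^ 2 * ((m : ℝ) ^ 2)⁻¹ := by
  have hm0 : (0 : ℝ) < m := lt_of_lt_of_le (by positivity) hm
  have hs : 0 < √ν := Real.sqrt_pos.2 hν
  set v : ℝ := √m / √ν with hv
  have hv1 : 1 + η ≤ v := by
    rw [hv, le_div_iff₀ hs]
    refine Real.le_sqrt_of_sq_le ?_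
    rwa [mul_pow, Real.sq_sqrt hν.le]
  have hv2 : v ^ 4 = (m : ℝ) ^ 2 / ν ^ 2 := by
    have : v ^ 2 = m / ν := by rw [hv, div_pow, Real.sq_sqrt hν.le, Real.sq_sqrt hm0.le]
    rw [show v ^ 4 = (v ^ 2) ^ 2 by ring, this, div_pow]
  have hy : η * γT ≤ γT * (v - 1) := by nlinarith
  have hy4 : 4 * (v - 1) ≤ γT * (v - 1) := by nlinarith
  refine (h.measureReal_exists_pulls_eq a (Nat.cast_pos.1 hm0) (y := γT * (v - 1))
    (le_trans (by positivity) hy)).trans ?_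
  have h1 : Real.exp (-((γT * (v - 1)) ^ 2 / 2)) ≤
      Real.exp (-((η * γT) ^ 2 / 4)) * Real.exp (-(4 * (v - 1) ^ 2)) := by
    rw [← Real.exp_add, Real.exp_le_exp]
    have h2 : (η * γT) ^ 2 ≤ (γT * (v - 1)) ^ 2 := pow_le_pow_left₀ (by positivity) hy 2
    have h3 : (4 * (v - 1)) ^ 2 ≤ (γT * (v - 1)) ^ 2 := pow_le_pow_left₀ (by linarith) hy4 2
    nlinarith
  refine h1.trans ?_
  have h4 : Real.exp (-(4 * (v - 1) ^ 2)) ≤ 4 * ν ^ 2 * ((m : ℝ) ^ 2)⁻¹ := by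
    have h5 := exp_neg_le_div_pow_four (v := v)
    rw [hv2, ← mul_div_assoc, div_le_iff₀ (by positivity)] at h5
    rwa [← div_eq_mul_inv, le_div_iff₀ (by positivity)]
  calc _ ≤ Real.exp (-((η * γT) ^ 2 / 4)) * (4 * ν ^ 2 * ((m : ℝ) ^ 2)⁻¹) := by gcongr
    _ = _ := by ring

theorem IsBanditRun.sum_measureReal_excessEvent_le (h : IsBanditRun P ℱ T ξ A) (hγ : 4 ≤ γT)
    (a : Fin K) {ν η : ℝ} (hν : 0 < ν) (hη : 0 < η) :
    ∑ m ∈ Finset.Ioo ⌊(1 + η) ^ 2 * ν⌋₊ (T + 1), P.real (excessEvent T γT ξ A a ν m) ≤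
      8 * Real.exp (-((η * γT) ^ 2 / 4)) * ν := by
  set k := ⌊(1 + η) ^ 2 * ν⌋₊
  have hk : (1 + η) ^ 2 * ν < k + 1 := Nat.lt_floor_add_one _
  have hk' : ν ≤ k + 1 := by nlinarith [mul_pos hη hν, mul_pos (mul_pos hη hη) hν]
  calc _ ≤ ∑ m ∈ Finset.Ioo k (T + 1),
          4 * Real.exp (-((η * γT) ^ 2 / 4)) * ν ^ 2 * ((m : ℝ) ^ 2)⁻¹ := by
        refine Finset.sum_le_sum fun m hm => h.measureReal_excessEvent_le hγ a hν hη ?_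
        have : (k : ℝ) + 1 ≤ m := by exact_mod_cast (Finset.mem_Ioo.1 hm).1
        linarith
    _ ≤ 4 * Real.exp (-((η * γT) ^ 2 / 4)) * ν ^ 2 * (2 / (k + 1)) := by
        rw [← Finset.mul_sum]
        gcongr
        exact sum_Ioo_inv_sq_le k (T + 1)
    _ = 8 * Real.exp (-((η * γT) ^ 2 / 4)) * (ν * (ν / (k + 1))) := by ring
    _ ≤ 8 * Real.exp (-((η * γT) ^ 2 / 4)) * ν := by
        gcongr
        exact mul_le_of_le_one_right hν.le (div_le_one_of_le₀ hk' (by positivity))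

/-- By `hsum` the non-excess pulls fall short of `T` by at least `T / γT`, while the expected total
excess is a small multiple of `∑ ν a ≤ T`. Markov's inequality loses only the factor `γT`. -/
theorem measureReal_not_exists_le_level (h : IsBanditRun P ℱ T ξ A) (hU : IsUCB1 μ σ γT T ξ A)
    (hT : 0 < T) (hKT : K ≤ T) (hσ : 0 < σ) (hγ : 4 ≤ γT) {τ η : ℝ} (hτ : -1 < τ)
    (hη : 0 < η) (hτT : ∑ a, levelPulls μ σ γT T τ a ≤ T)
    (hsum : (1 + η) ^ 2 * ∑ a, levelPulls μ σ γT T τ a + K + T / γT ≤ T) :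
    P.real {ω | ¬∃ t ∈ Finset.Ico K T, ∀ b, ucbIndex μ σ γT ξ A b t ω ≤ level μ σ γT T τ} ≤
      8 * γT * Real.exp (-((η * γT) ^ 2 / 4)) := by
  have hγ0 : 0 < γT := by linarith
  have hT' : (0 : ℝ) < T := by exact_mod_cast hT
  set ν := levelPulls μ σ γT T τ
  have hν : ∀ a, 0 < ν a := fun a => levelPulls_pos μ hT hσ hγ0 a hτ
  set I : Finset (Σ _ : Fin K, ℕ) :=
    Finset.univ.sigma fun a => Finset.Ioo ⌊(1 + η) ^ 2 * ν a⌋₊ (T + 1)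
  calc _ ≤ P.real {ω | T / γT ≤ ∑ i ∈ I,
          (1 : ℝ) * (excessEvent T γT ξ A i.1 (ν i.1) i.2).indicator 1 ω} := by
        refine measureReal_mono (fun ω hω => ?_) (measure_ne_top _ _)
        have h1 : ∀ a, (pulls A a T ω : ℝ) ≤ 1 + (1 + η) ^ 2 * ν a +
            ∑ m ∈ Finset.Ioo ⌊(1 + η) ^ 2 * ν a⌋₊ (T + 1),
              1 * (excessEvent T γT ξ A a (ν a) m).indicator 1 ω := by
          intro a
          refine hU.pulls_le_add_sum_excessEvent hσ hKT (hν a) ?_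
          rw [← level_eq μ hT hσ hγ0 a hτ]
          exact hω
        have h2 := Finset.sum_le_sum fun a (_ : a ∈ Finset.univ) => h1 a
        have h3 : ∑ a, (pulls A a T ω : ℝ) = T := by exact_mod_cast sum_pulls A T ω
        rw [h3, Finset.sum_add_distrib, Finset.sum_add_distrib, ← Finset.mul_sum] at h2
        simp only [Finset.sum_const, Finset.card_univ, Fintype.card_fin, nsmul_eq_mul,
          mul_one] at h2
        change (T : ℝ) / γT ≤ ∑ i ∈ I,
          (1 : ℝ) * (excessEvent T γT ξ A i.1 (ν i.1) i.2).indicator 1 ω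
        rw [Finset.sum_sigma]
        dsimp only
        linarith
    _ ≤ (∑ i ∈ I, (1 : ℝ) * P.real (excessEvent T γT ξ A i.1 (ν i.1) i.2)) / (T / γT) :=
        measureReal_le_sum_indicator_le I _ (fun _ _ => zero_le_one) _ (by positivity)
    _ ≤ (8 * Real.exp (-((η * γT) ^ 2 / 4)) * T) / (T / γT) := by
        gcongr
        rw [Finset.sum_sigma]
        simp only [one_mul]
        calc _ ≤ ∑ a, 8 * Real.exp (-((η * γT) ^ 2 / 4)) * ν a :=
              Finset.sum_le_sum fun a _ => h.sum_measureReal_excessEvent_le hγ a (hν a) hη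
          _ ≤ _ := by
              rw [← Finset.mul_sum]
              gcongr
    _ = _ := by field_simp

/-- Arms outside `B a` have at least `(1 - η) ^ 2 * ν a` pulls at time `t < T`, so the arms in `B a`
must carry a fraction `1 / γT` of `∑ ν a`. Markov's inequality with weights `ν a` bounds this. -/
theorem measureReal_exists_le_level (h : IsBanditRun P ℱ T ξ A) (hU : IsUCB1 μ σ γT T ξ A)
    (hT : 1 ≤ Real.log T) (hK : 0 < K) (hσ : 0 < σ) (hγ : 0 < γT) {τ η : ℝ}
    (hτ : -1 < τ) (hη : η ≤ 1) (hηγ : 1 ≤ η * γT)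
    (hsum : T ≤ (1 - η) ^ 2 * (1 - 1 / γT) * ∑ a, levelPulls μ σ γT T τ a) :
    P.real {ω | ∃ t ∈ Finset.Ico K T, ∀ b, ucbIndex μ σ γT ξ A b t ω ≤ level μ σ γT T τ} ≤
      4 * γT * (Real.log T * (η * γT * Real.exp (-(η * γT) ^ 2 / 2))) := by
  have : Nonempty (Fin K) := ⟨⟨0, hK⟩⟩
  have hT0 : 0 < T := by
    rcases Nat.eq_zero_or_pos T with h0 | h0
    · norm_num [h0] at hT
    · exact h0
  set ν := levelPulls μ σ γT T τ
  have hν : ∀ a, 0 < ν a := fun a => levelPulls_pos μ hT0 hσ hγ a hτ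
  have hνs : 0 < ∑ a, ν a := Finset.sum_pos (fun a _ => hν a) Finset.univ_nonempty
  set B : Fin K → Set Ω := fun a => {ω | ∃ t ∈ Finset.Icc 1 T, 0 < pulls A a t ω ∧
      η * γT * √(pulls A a t ω) ≤ -1 * noiseSum ξ A a t ω} with hB
  calc _ ≤ P.real {ω | (∑ a, ν a) / γT ≤ ∑ a, ν a * (B a).indicator 1 ω} := by
        refine measureReal_mono (fun ω hω => ?_) (measure_ne_top _ _)
        obtain ⟨t, ht, hle⟩ := hω
        rw [Finset.mem_Ico] at ht
        have h1 : ∀ a, (1 - η) ^ 2 * (ν a - ν a * (B a).indicator 1 ω) ≤ pulls A a t ω := by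
          intro a
          by_cases hb : ω ∈ B a
          · simp [hb]
          · rw [Set.indicator_of_notMem hb, mul_zero, sub_zero]
            have hp := hU.pulls_pos a ht.1 ω
            refine mul_le_pulls_of_ucbIndex_le (ξ := ξ) (σ := σ) (μ := μ) hσ hγ hp (hν a) hη ?_ ?_
            · rw [← level_eq μ hT0 hσ hγ a hτ]
              exact hle a
            · by_contra hc
              refine hb ⟨t, Finset.mem_Icc.2 ⟨by omega, by omega⟩, hp, ?_⟩
              linarith
        have h2 := Finset.sum_le_sum fun a (_ : a ∈ Finset.univ) => h1 a
        have h3 : ∑ a, (pulls A a t ω : ℝ) = t := by exact_mod_cast sum_pulls A t ω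
        rw [h3, ← Finset.mul_sum, Finset.sum_sub_distrib] at h2
        have h4 : (t : ℝ) < T := by exact_mod_cast ht.2
        change _ ≤ ∑ a, ν a * (B a).indicator 1 ω
        by_contra hc
        rw [not_le] at hc
        have h5 : (1 - η) ^ 2 * (1 - 1 / γT) * ∑ a, ν a =
            (1 - η) ^ 2 * (∑ a, ν a - (∑ a, ν a) / γT) := by ring
        have h6 : (1 - η) ^ 2 * (∑ a, ν a - (∑ a, ν a) / γT) ≤
            (1 - η) ^ 2 * (∑ a, ν a - ∑ a, ν a * (B a).indicator 1 ω) := by gcongr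
        linarith
    _ ≤ (∑ a, ν a * P.real (B a)) / ((∑ a, ν a) / γT) :=
        measureReal_le_sum_indicator_le _ _ (fun a _ => (hν a).le) _ (by positivity)
    _ ≤ (∑ a, ν a * (4 * (Real.log T * (η * γT * Real.exp (-(η * γT) ^ 2 / 2))))) /
          ((∑ a, ν a) / γT) := by
        gcongr with a _
        · exact (hν a).le
        · exact h.measureReal_exists_sqrt_pulls_le a hT (by norm_num) hηγ
    _ = _ := by
        rw [← Finset.sum_mul]
        field_simp

end Run

/-! ### From the level to the pulls of one arm -/

section Main

variable {Ω : Type*} {K T : ℕ} {μ : Fin K → ℝ} {σ γT : ℝ} {ξ : ℕ → Ω → ℝ} {A : ℕ → Ω → Fin K}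

theorem IsUCB1.le_pulls_div (h : IsUCB1 μ σ γT T ξ A) (hT : 0 < T) (hσ : 0 < σ) (hγ : 0 < γT)
    {ω : Ω} {a : Fin K} {τ η : ℝ} (hτ : 0 ≤ τ) (hτ' : τ ≤ 1 / 2) (hη : 0 ≤ η) (hη' : η ≤ 1)
    (hℓ : ∃ t ∈ Finset.Ico K T, ∀ b, ucbIndex μ σ γT ξ A b t ω ≤ level μ σ γT T τ)
    (hξ : ∀ t ∈ Finset.Icc 1 T, 0 < pulls A a t ω →
      -noiseSum ξ A a t ω ≤ η * γT * √(pulls A a t ω)) :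
    1 - 2 * η - 2 * τ ≤ pulls A a T ω / nStarArm μ σ γT T a := by
  obtain ⟨t, ht, hle⟩ := hℓ
  rw [Finset.mem_Ico] at ht
  have hK := a.pos
  have hp := h.pulls_pos a ht.1 ω
  have hn := nStarArm_pos μ hT hσ hγ a
  have hle' := hle a
  rw [level_eq μ hT hσ hγ a (by linarith)] at hle'
  have h1 := mul_le_pulls_of_ucbIndex_le hσ hγ hp
    (levelPulls_pos μ hT hσ hγ a (by linarith : -1 < τ)) hη' hle'
    (hξ t (Finset.mem_Icc.2 ⟨by omega, by omega⟩) hp)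
  have h2 : (pulls A a t ω : ℝ) ≤ pulls A a T ω := by
    exact_mod_cast pulls_mono A a ω ht.2.le
  have h3 := mul_le_levelPulls μ hT hσ hγ a hτ
  rw [le_div_iff₀ hn]
  calc (1 - 2 * η - 2 * τ) * nStarArm μ σ γT T a
      ≤ ((1 - η) ^ 2 * (1 - 2 * τ)) * nStarArm μ σ γT T a := by
        gcongr
        nlinarith [mul_nonneg hη hτ, mul_nonneg (sq_nonneg η) (by linarith : 0 ≤ 1 - 2 * τ)]
    _ = (1 - η) ^ 2 * (nStarArm μ σ γT T a * (1 - 2 * τ)) := by ring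
    _ ≤ (1 - η) ^ 2 * levelPulls μ σ γT T τ a := by gcongr
    _ ≤ pulls A a T ω := h1.trans h2

theorem IsUCB1.pulls_div_le (h : IsUCB1 μ σ γT T ξ A) (hT : 0 < T) (hKT : K ≤ T) (hσ : 0 < σ)
    (hγ : 0 < γT) {ω : Ω} {a : Fin K} {ρ η : ℝ} (hρ : 0 ≤ ρ) (hρ' : ρ ≤ 1 / 2) (hη : 0 ≤ η)
    (hη' : η ≤ 1)
    (hℓ : ¬∃ t ∈ Finset.Ico K T, ∀ b, ucbIndex μ σ γT ξ A b t ω ≤ level μ σ γT T (-ρ))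
    (hξ : ∀ t ∈ Finset.Icc 1 T, 0 < pulls A a t ω →
      noiseSum ξ A a t ω ≤ η * γT * √(pulls A a t ω)) :
    pulls A a T ω / nStarArm μ σ γT T a ≤
      1 / nStarArm μ σ γT T a + (1 + 12 * η + 6 * ρ) := by
  have hK := a.pos
  have hn := nStarArm_pos μ hT hσ hγ a
  have hν := levelPulls_pos μ hT hσ hγ a (by linarith : -1 < -ρ)
  have h1 : (pulls A a T ω : ℝ) ≤ 1 + (1 + η) ^ 2 * levelPulls μ σ γT T (-ρ) a := by
    have hp := h.pulls_pos a hKT ω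
    rcases Nat.lt_or_ge 1 (pulls A a T ω) with h2 | h2
    · obtain ⟨t, ht, h3, h4⟩ := h.exists_lt_ucbIndex hKT hℓ
        (by omega : 1 ≤ pulls A a T ω - 1) (by omega : pulls A a T ω - 1 < pulls A a T ω)
      rw [Finset.mem_Ico] at ht
      rw [level_eq μ hT hσ hγ a (by linarith)] at h4
      have hpt := h.pulls_pos a ht.1 ω
      have h5 := pulls_le_of_lt_ucbIndex hσ hγ hpt hν h4
        (hξ t (Finset.mem_Icc.2 ⟨by omega, by omega⟩) hpt)
      have h6 : (pulls A a T ω : ℝ) = pulls A a t ω + 1 := by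
        exact_mod_cast (by omega : pulls A a T ω = pulls A a t ω + 1)
      linarith
    · have h3 : (pulls A a T ω : ℝ) ≤ 1 := by exact_mod_cast h2
      have : 0 ≤ (1 + η) ^ 2 * levelPulls μ σ γT T (-ρ) a := by positivity
      linarith
  have h2 := levelPulls_neg_le μ hT hσ hγ a hρ hρ'
  rw [div_le_iff₀ hn, add_mul, one_div_mul_cancel hn.ne']
  refine h1.trans (add_le_add le_rfl ?_)
  calc (1 + η) ^ 2 * levelPulls μ σ γT T (-ρ) a
      ≤ (1 + η) ^ 2 * (nStarArm μ σ γT T a * (1 + 6 * ρ)) := by gcongr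
    _ = ((1 + η) ^ 2 * (1 + 6 * ρ)) * nStarArm μ σ γT T a := by ring
    _ ≤ _ := by
        gcongr
        have h3 : (1 + η) ^ 2 ≤ 1 + 3 * η := by nlinarith
        calc (1 + η) ^ 2 * (1 + 6 * ρ) ≤ (1 + 3 * η) * (1 + 6 * ρ) := by gcongr
          _ ≤ 1 + 12 * η + 6 * ρ := by nlinarith [mul_nonneg hη (by linarith : 0 ≤ 1 / 2 - ρ)]

end Main

/-! ### Budget estimates for the shifts `± 200 δ` -/

section Rate

variable {Ω : Type*} [mΩ : MeasurableSpace Ω] {P : Measure Ω} [IsProbabilityMeasure P]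
  {ℱ : Filtration ℕ mΩ} {K T : ℕ} {μ : Fin K → ℝ} {σ γT : ℝ} {ξ : ℕ → Ω → ℝ}
  {A : ℕ → Ω → Fin K} {δ ε η : ℝ}

/-- The shift frees `100 * ε * T` pulls. This pays for `(1 + η) ^ 2 ≤ 1 + 63 * ε`, the `K` initial
pulls and the slack `T / γT`. -/
theorem measureReal_not_exists_le_level_of_le (hrun : IsBanditRun P ℱ T ξ A)
    (hU : IsUCB1 μ σ γT T ξ A) (hT : 0 < T) (hK : 0 < K) (hKT : K ≤ T) (hσ : 0 < σ)
    (hγ : 4 ≤ γT) (hδ0 : 0 ≤ δ) (hτ : 200 * δ ≤ 1 / 2) (hδD : δ * DStar μ σ γT T = ε)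
    (hε0 : 0 ≤ ε) (hε : ε ≤ 1 / 10 ^ 5) (hη0 : 0 < η) (hηε : η ≤ 21 * ε)
    (hKε : (K : ℝ) / T ≤ ε) (hγε : 1 / γT ≤ ε) :
    P.real {ω | ¬∃ t ∈ Finset.Ico K T,
        ∀ b, ucbIndex μ σ γT ξ A b t ω ≤ level μ σ γT T (200 * δ)} ≤
      8 * γT * Real.exp (-((η * γT) ^ 2 / 4)) := by
  have hγ0 : 0 < γT := by linarith
  have hT' : (0 : ℝ) < T := by exact_mod_cast hT
  have hs := sum_levelPulls_le μ hT hσ hγ0 hK (by positivity : 0 ≤ 200 * δ) (by linarith)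
  have e : (T : ℝ) * (1 - 200 * δ * DStar μ σ γT T / 2) = T * (1 - 100 * ε) := by
    rw [← hδD]; ring
  rw [e] at hs
  refine measureReal_not_exists_le_level hrun hU hT hKT hσ hγ (by linarith) hη0
    (hs.trans (mul_le_of_le_one_right hT'.le (by linarith))) ?_
  have h1 : (1 + η) ^ 2 ≤ 1 + 63 * ε := by
    have : η ^ 2 ≤ η := by rw [sq]; exact mul_le_of_le_one_right hη0.le (by linarith)
    linarith
  have h2 : (K : ℝ) ≤ T * ε := by rwa [div_le_iff₀' hT'] at hKε
  have h3 : (T : ℝ) / γT ≤ T * ε := by rw [div_eq_mul_one_div]; gcongr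
  have h4 : (1 + η) ^ 2 * ∑ b, levelPulls μ σ γT T (200 * δ) b ≤
      (1 + 63 * ε) * (T * (1 - 100 * ε)) := by
    refine mul_le_mul h1 hs ?_ (by positivity)
    exact Finset.sum_nonneg fun b _ =>
      (levelPulls_pos μ hT hσ hγ0 b (by linarith : -1 < 200 * δ)).le
  have h5 : (1 + 63 * ε) * (T * (1 - 100 * ε)) + T * ε + T * ε =
      T * (1 - (35 * ε + 6300 * ε ^ 2)) := by ring
  have h6 : T * (1 - (35 * ε + 6300 * ε ^ 2)) ≤ (T : ℝ) :=
    mul_le_of_le_one_right hT'.le (sub_le_self _ (by positivity))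
  linarith

/-- Here the shift raises the total by the factor `1 + 400 * ε`, which outweighs the losses `(1 - 42
* ε) * (1 - ε)`. -/
theorem measureReal_exists_le_level_of_le (hrun : IsBanditRun P ℱ T ξ A)
    (hU : IsUCB1 μ σ γT T ξ A) (hT : 0 < T) (hlogT : 1 ≤ Real.log T) (hK : 0 < K) (hσ : 0 < σ)
    (hγ : 0 < γT) (hδ0 : 0 ≤ δ) (hτ : 200 * δ ≤ 1 / 2) (hδD : δ * DStar μ σ γT T = ε)
    (hε0 : 0 ≤ ε) (hε : ε ≤ 1 / 10 ^ 5) (hηγ : 1 ≤ η * γT) (hηε : η ≤ 21 * ε)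
    (hγε : 1 / γT ≤ ε) :
    P.real {ω | ∃ t ∈ Finset.Ico K T,
        ∀ b, ucbIndex μ σ γT ξ A b t ω ≤ level μ σ γT T (-(200 * δ))} ≤
      4 * γT * (Real.log T * (η * γT * Real.exp (-(η * γT) ^ 2 / 2))) := by
  have hT' : (0 : ℝ) < T := by exact_mod_cast hT
  have hs := le_sum_levelPulls μ hT hσ hγ hK (by positivity : 0 ≤ 200 * δ) hτ
  have e : (T : ℝ) * (1 + 2 * (200 * δ) * DStar μ σ γT T) = T * (1 + 400 * ε) := by
    rw [← hδD]; ring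
  rw [e] at hs
  refine measureReal_exists_le_level hrun hU hlogT hK hσ hγ (by linarith) (by linarith) hηγ ?_
  have h1 : 1 - 42 * ε ≤ (1 - η) ^ 2 := by
    have : (1 - η) ^ 2 = 1 - 2 * η + η ^ 2 := by ring
    linarith [sq_nonneg η]
  have h2 : (1 - 42 * ε) * (1 - ε) ≤ (1 - η) ^ 2 * (1 - 1 / γT) :=
    mul_le_mul h1 (by linarith) (by linarith) (by positivity)
  have h3 : 1 ≤ (1 - 42 * ε) * (1 - ε) * (1 + 400 * ε) := by
    have : (1 - 43 * ε) ≤ (1 - 42 * ε) * (1 - ε) := by nlinarith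
    calc (1 : ℝ) ≤ (1 - 43 * ε) * (1 + 400 * ε) := by nlinarith
      _ ≤ _ := by gcongr
  calc (T : ℝ) ≤ T * ((1 - 42 * ε) * (1 - ε) * (1 + 400 * ε)) :=
        le_mul_of_one_le_right hT'.le h3
    _ = ((1 - 42 * ε) * (1 - ε)) * (T * (1 + 400 * ε)) := by ring
    _ ≤ _ := by
        refine mul_le_mul h2 hs (by positivity) (le_trans ?_ h2)
        exact mul_nonneg (by linarith) (by linarith)

end Rate

/-- `21 ^ 2 / 4 ≥ 101`: one power of `γT` beyond `100` repays the loss in Markov's inequality, and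
`l = log T` cancels the factor `log T` of the iterated logarithm bound. -/
theorem exp_neg_sq_div_four_le {γT l : ℝ} (hγ : 1 ≤ γT) (hl : 1 ≤ l) :
    Real.exp (-((21 * (√(Real.log γT) + √(Real.log l))) ^ 2 / 4)) ≤ (γT ^ 101)⁻¹ * l⁻¹ := by
  have hγ0 : 0 < γT := by linarith
  have hl0 : 0 < l := by linarith
  have h1 := Real.sq_sqrt (Real.log_nonneg hγ)
  have h2 := Real.sq_sqrt (Real.log_nonneg hl)
  have h3 := mul_nonneg (Real.sqrt_nonneg (Real.log γT)) (Real.sqrt_nonneg (Real.log l))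
  have e : (γT ^ 101)⁻¹ * l⁻¹ = Real.exp (-(101 * Real.log γT + Real.log l)) := by
    rw [neg_add, Real.exp_add, Real.exp_neg, Real.exp_neg, Real.exp_log hl0]
    congr 2
    rw [← Real.exp_log (pow_pos hγ0 101), Real.log_pow]
    norm_num
  rw [e, Real.exp_le_exp]
  nlinarith [Real.log_nonneg hγ, Real.log_nonneg hl]

theorem mul_exp_neg_sq_div_two_le (w : ℝ) :
    w * Real.exp (-w ^ 2 / 2) ≤ Real.exp (-(w ^ 2 / 4)) := by
  have h1 : w ≤ Real.exp (w ^ 2 / 4) := by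
    nlinarith [Real.add_one_le_exp (w ^ 2 / 4), sq_nonneg (w - 2)]
  calc w * Real.exp (-w ^ 2 / 2) ≤ Real.exp (w ^ 2 / 4) * Real.exp (-w ^ 2 / 2) := by gcongr
    _ = _ := by rw [← Real.exp_add]; ring_nf

end Bandit

end

/-! ### Choice of constants and union of four events -/

theorem mainTheorem4 :
    ∃ C : ℝ, 0 < C ∧
      ∀ (γ : ℝ), 1 ≤ γ →
      ∀ (K T : ℕ) (μ : Fin K → ℝ) (σ γT : ℝ), 0 < T → 0 < σ → 0 < γT →
      max (Bandit.err μ σ γT T) (γ / γT) ≤ 1 / C →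
      (Bandit.DStar μ σ γT T)⁻¹ * Bandit.epsT K γT T ≤ 1 / C →
      ∀ (Ω : Type*) [mΩ : MeasurableSpace Ω] (P : MeasureTheory.Measure Ω)
        [MeasureTheory.IsProbabilityMeasure P] (ℱ : MeasureTheory.Filtration ℕ mΩ)
        (ξ : ℕ → Ω → ℝ) (A : ℕ → Ω → Fin K),
      Bandit.IsBanditRun P ℱ T ξ A → Bandit.IsUCB1 μ σ γT T ξ A →
      ∀ a : Fin K,
        P.real {ω | C * ((Bandit.DStar μ σ γT T)⁻¹ * Bandit.err μ σ γT T + γ / γT) ≤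
            |(Bandit.pulls A a T ω : ℝ) / Bandit.nStarArm μ σ γT T a - 1|} ≤
          C * ((γT ^ 100)⁻¹ + Real.log T * (γ * Real.exp (-γ ^ 2 / 2))) := by
  open Bandit in
  refine ⟨10 ^ 5, by norm_num, ?_⟩
  intro γ hγ1 K T μ σ γT hT hσ hγ herr heps Ω mΩ P _ ℱ ξ A hrun hU a
  have hK := a.pos
  have hT' : (0 : ℝ) < T := by exact_mod_cast hT
  have hK' : (1 : ℝ) ≤ K := by exact_mod_cast hK
  obtain ⟨herr', hγγ⟩ := max_le_iff.1 herr
  have hγT : 10 ^ 5 ≤ γT := by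
    rw [div_le_div_iff₀ hγ (by norm_num)] at hγγ
    linarith
  -- the size of the error terms
  have hlog0 : 0 ≤ logRate γT T := by unfold logRate; positivity
  have hgap0 : 0 ≤ ‖fun a => gap μ a / σ‖ ^ 2 / γT ^ 2 := by positivity
  have hKT0 : 0 < (K : ℝ) / T := by positivity
  have herr_eq : err μ σ γT T =
    logRate γT T + (K : ℝ) / T + ‖fun a => gap μ a / σ‖ ^ 2 / γT ^ 2 := rfl
  have hKT1 : (K : ℝ) / T ≤ 1 / 10 ^ 5 := by linarith
  have hKT2 : 10 ^ 5 * (K : ℝ) ≤ T := by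
    rw [div_le_div_iff₀ hT' (by norm_num)] at hKT1
    linarith
  have hKT : K ≤ T := by
    have : (K : ℝ) ≤ T := by linarith
    exact_mod_cast this
  have hlogT : 1 ≤ Real.log T := by
    rw [Real.le_log_iff_exp_le hT']
    linarith [Real.exp_one_lt_d9]
  have hlogγ : 1 ≤ Real.log γT := by
    rw [Real.le_log_iff_exp_le hγ]
    linarith [Real.exp_one_lt_d9]
  set ε := epsT K γT T with hε
  set D := DStar μ σ γT T
  have hε1 : logRate γT T ≤ ε := le_max_left _ _
  have hε2 : (K : ℝ) / T ≤ ε := le_max_right _ _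
  have hε0 : 0 < ε := hKT0.trans_le hε2
  have hεerr : ε ≤ err μ σ γT T := max_le (by linarith) (by linarith)
  have hD0 : 0 < D := DStar_pos μ hT hσ hγ hK
  have hD1 : 1 ≤ D⁻¹ := (one_le_inv₀ hD0).2 (DStar_le_one μ hT hσ hγ hK)
  set δ := D⁻¹ * ε with hδ
  have hδ0 : 0 < δ := by positivity
  have hδε : ε ≤ δ := le_mul_of_one_le_left hε0.le hD1
  have hδD : δ * D = ε := by rw [hδ]; field_simp
  have hδerr : δ ≤ D⁻¹ * err μ σ γT T := by rw [hδ]; gcongr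
  have herrD : err μ σ γT T ≤ D⁻¹ * err μ σ γT T :=
    le_mul_of_one_le_left (hε0.le.trans hεerr) hD1
  have hε5 : ε ≤ 1 / 10 ^ 5 := hδε.trans heps
  -- The noise tolerance used for all arms when locating the level; arm `a` itself gets the
  -- tolerance `γ / γT` below.
  set η := 21 * logRate γT T with hη
  have hηγ : η * γT = 21 * (√(Real.log γT) + √(Real.log (Real.log T))) := by
    rw [hη, logRate]; field_simp
  have hηγ1 : 1 ≤ η * γT := by
    rw [hηγ]
    linarith [Real.one_le_sqrt.2 hlogγ, Real.sqrt_nonneg (Real.log (Real.log T))]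
  have hη0 : 0 < η := pos_of_mul_pos_left (by linarith) hγ.le
  have hηε : η ≤ 21 * ε := by linarith
  have hγε : 1 / γT ≤ ε := by
    refine le_trans ?_ hε1
    rw [logRate]
    gcongr
    linarith [Real.one_le_sqrt.2 hlogγ, Real.sqrt_nonneg (Real.log (Real.log T))]
  have hexp := exp_neg_sq_div_four_le (by linarith : 1 ≤ γT) hlogT
  rw [← hηγ] at hexp
  have hτ : 200 * δ ≤ 1 / 2 := by linarith
  -- some index vector lies below the level `200 δ`
  have hB1 : P.real {ω | ¬∃ t ∈ Finset.Ico K T,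
      ∀ b, ucbIndex μ σ γT ξ A b t ω ≤ level μ σ γT T (200 * δ)} ≤ 8 * (γT ^ 100)⁻¹ := by
    refine (measureReal_not_exists_le_level_of_le hrun hU hT hK hKT hσ (by linarith) hδ0.le hτ hδD
      hε0.le hε5 hη0 hηε hε2 hγε).trans ?_
    calc _ ≤ 8 * γT * ((γT ^ 101)⁻¹ * (Real.log T)⁻¹) := by gcongr
        _ ≤ 8 * γT * ((γT ^ 101)⁻¹ * 1) := by
            gcongr
            exact inv_le_one_of_one_le₀ hlogT
        _ = 8 * (γT ^ 100)⁻¹ := by field_simp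
  -- no index vector lies below the level `- 200 δ`
  have hB2 : P.real {ω | ∃ t ∈ Finset.Ico K T,
      ∀ b, ucbIndex μ σ γT ξ A b t ω ≤ level μ σ γT T (-(200 * δ))} ≤ 4 * (γT ^ 100)⁻¹ := by
    refine (measureReal_exists_le_level_of_le hrun hU hT hlogT hK hσ hγ hδ0.le hτ hδD hε0.le
      hε5 hηγ1 hηε hγε).trans ?_
    calc _ ≤ 4 * γT * (Real.log T * ((γT ^ 101)⁻¹ * (Real.log T)⁻¹)) := by
            refine mul_le_mul_of_nonneg_left (mul_le_mul_of_nonneg_left ?_ (by linarith))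
              (by linarith)
            exact (mul_exp_neg_sq_div_two_le _).trans hexp
        _ = 4 * (γT ^ 100)⁻¹ := by field_simp
  -- the noise of arm `a`
  have hB3 := hrun.measureReal_exists_sqrt_pulls_le a hlogT (ε := 1) (by norm_num) hγ1
  have hB4 := hrun.measureReal_exists_sqrt_pulls_le a hlogT (ε := -1) (by norm_num) hγ1
  set B1 := {ω | ¬∃ t ∈ Finset.Ico K T,
      ∀ b, ucbIndex μ σ γT ξ A b t ω ≤ level μ σ γT T (200 * δ)}
  set B2 := {ω | ∃ t ∈ Finset.Ico K T,
      ∀ b, ucbIndex μ σ γT ξ A b t ω ≤ level μ σ γT T (-(200 * δ))}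
  set B3 := {ω | ∃ t ∈ Finset.Icc 1 T, 0 < pulls A a t ω ∧
      γ * √(pulls A a t ω) ≤ 1 * noiseSum ξ A a t ω} with hB3d
  set B4 := {ω | ∃ t ∈ Finset.Icc 1 T, 0 < pulls A a t ω ∧
      γ * √(pulls A a t ω) ≤ -1 * noiseSum ξ A a t ω} with hB4d
  have hsub : {ω | 10 ^ 5 * (D⁻¹ * err μ σ γT T + γ / γT) ≤
      |(pulls A a T ω : ℝ) / nStarArm μ σ γT T a - 1|} ⊆ B1 ∪ B2 ∪ (B3 ∪ B4) := by
    intro ω hω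
    by_contra hc
    simp only [Set.mem_union, not_or] at hc
    obtain ⟨⟨h1, h2⟩, h3, h4⟩ := hc
    have hγ0 : 0 < γ / γT := by positivity
    have hγc : γ / γT * γT = γ := by field_simp
    have hlow := hU.le_pulls_div hT hσ hγ (by positivity) hτ hγ0.le (by linarith)
      (not_not.1 h1) (a := a) (fun t ht hp => by
        rw [hγc]
        by_contra hc
        exact h4 ⟨t, ht, hp, by linarith⟩)
    have hup := hU.pulls_div_le hT hKT hσ hγ (by positivity) hτ hγ0.le (by linarith)
      h2 (a := a) (fun t ht hp => by
        rw [hγc]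
        by_contra hc
        exact h3 ⟨t, ht, hp, by linarith⟩)
    have hinv := inv_nStarArm_le μ hT hσ hγ a
    refine absurd (Set.mem_ofPred.1 hω) (not_le.2 ?_)
    rw [abs_lt]
    -- The deviations are at most `2 γ / γT + 400 δ` below and `2 err + 12 γ / γT + 1200 δ` above,
    -- well within the constant `10 ^ 5`.
    constructor <;> linarith
  have hfin := (measureReal_mono hsub (measure_ne_top P _)).trans
    ((measureReal_union_le _ _).trans
      (add_le_add (measureReal_union_le B1 B2) (measureReal_union_le B3 B4)))
  have hp1 : 0 ≤ (γT ^ 100)⁻¹ := by positivity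
  have hp2 : 0 ≤ Real.log T * (γ * Real.exp (-γ ^ 2 / 2)) := by positivity
  linarith
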